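/- Let $\omega$ be a non-principal ultrafilter on $\mathbb{N}$, let $(A_i)_{i\in\mathbb N}$ be compact (Hausdorff) abelian groups with normalized Haar measures $\mu_i$, and let $\mathbf{A}=\prod_\omega A_i$ be their ultraproduct. A subset of $\mathbf A$ is strongly open if it is an ultraproduct $\prod_\omega U_i$ of open sets $U_i\subseteq A_i$, and open if it is a countable union of strongly open sets; a map from $\mathbf A$ to a topological space is continuous if preimages of open sets are open. The Borel $\sigma$-algebra of $\mathbf A$ is generated by the strongly open sets, and it carries the ultralimit probability measure $\mu$, determined by $\mu(\prod_\omega U_i)=\lim_\omega\mu_i(U_i)$. Let $\hat{\mathbf A}$ be the group of linear characters of $\mathbf A$, i.e. the continuous homomorphisms from $\mathbf A$ to the complex unit circle, and let the Fourier $\sigma$-algebra $\mathcal F(\mathbf A)$ be the $\sigma$-algebra generated by them. For $f\in L^\infty(\mathbf A)$ let $\hat f(\chi)=\int f\overline{\chi}\,d\mu$ for $\chi\in\hat{\mathbf A}$. For an $L^2$ function $g$ on a second countable compact abelian group $G$ let $\hat g:\hat G\to\mathbb C$ be its usual Fourier transform. Two complex functions $u_1,u_2$ on discrete groups are isomorphic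 if there is a group isomorphism $\alpha:\langle \mathrm{supp}\,u_1\rangle\to\langle\mathrm{supp}\,u_2\rangle$ with $u_1=u_2\circ\alpha$. For $\epsilon>0$, an $\epsilon$-isomorphism from $u_1:\Gamma_1\to\mathbb C$ to $u_2:\Gamma_2\to\mathbb C$ is a bijection $\psi:S_1\to S_2$, where $\{|u_j|>\epsilon\}\subseteq S_j\subseteq \Gamma_j$ for $j=1,2$, such that $|u_1-u_2\circ\psi|\le\epsilon$ on $S_1$ and, with $n=\lceil 1/\epsilon\rceil$, $g_1^{a_1}\cdots g_n^{a_n}=1\iff\psi(g_1)^{a_1}\cdots\psi(g_n)^{a_n}=1$ for all $g_i\in S_1$, $a_i\in\{-1,0,1\}$; $\hat d(u_1,u_2)$ is the infimum of all $\epsilon>0$ for which an $\epsilon$-isomorphism exists. Two $L^2$ functions $g_1,g_2$ on second countable compact abelian groups $G_1,G_2$ are isomorphic if there are an $L^2$ function $g_3$ on a second countable compact abelian group $G_3$ and continuous epimorphisms $\alpha_j:G_j\to G_3$ with $g_3\circ\alpha_j=g_j$ almost everywhere ($j=1,2$); put $d(g_1,g_2)=\hat d(\hat g_1,\hat g_2)$.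 Finally, $\mathcal Q(f)$ is the class of all $L^2$ functions $g$ on second countable compact abelian groups such that $\hat g$ is isomorphic to $\hat f$. Theorem. A function $f\in L^\infty(\mathbf A)$ is measurable in $\mathcal F(\mathbf A)$ (i.e. almost everywhere equal to an $\mathcal F(\mathbf A)$-measurable function) if and only if there are a second countable compact abelian group $A$, a continuous, surjective, measure preserving homomorphism $\phi:\mathbf A\to A$ (with normalized Haar measure on $A$) and a function $h\in L^\infty(A)$ such that $f=h\circ\phi$ almost everywhere. Furthermore, for all such $A$, $\phi$, $h$ we have $d(h,\mathcal Q(f))=0$, i.e. $d(h,g)=0$ for every $g\in\mathcal Q(f)$, and the isomorphism class of $h$ is $\mathcal Q(f)$. -/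

import Mathlib

open MeasureTheory Filter Topology Set
open scoped ENNReal ComplexConjugate

universe u v

noncomputable section

namespace UltraFourier

/-! ### Ultraproducts -/

section Ultraproduct

variable (ω : Ultrafilter ℕ) (X : ℕ → Type u)

/-- The ultraproduct of the sets `X i`: sequences modulo equality `ω`-almost everywhere. -/
def UltraProd : Type u := (ω : Filter ℕ).Product X

variable {X}

/-- The class of a sequence in the ultraproduct. -/
def UltraProd.mk (a : ∀ i, X i) : UltraProd ω X :=
  Quotient.mk (productSetoid (ω : Filter ℕ) X) a

lemma mk_surjective : Function.Surjective (UltraProd.mk ω (X := X)) :=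
  Quotient.mk_surjective

/-- The ultraproduct of the subsets `S i ⊆ X i`, as a subset of the ultraproduct of the `X i`. -/
def ultraSet (S : ∀ i, Set (X i)) : Set (UltraProd ω X) :=
  fun x => Quotient.liftOn x (fun a => ∀ᶠ i in (ω : Filter ℕ), a i ∈ S i) (by
    intro a b hab
    have h : ∀ᶠ i in (ω : Filter ℕ), a i = b i := hab
    refine propext ⟨fun ha => ?_, fun hb => ?_⟩
    · filter_upwards [h, ha] with i h1 h2
      rwa [← h1]
    · filter_upwards [h, hb] with i h1 h2
      rwa [h1])

lemma mk_mem_ultraSet (S : ∀ i, Set (X i)) (a : ∀ i, X i) :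
    UltraProd.mk ω a ∈ ultraSet ω S ↔ ∀ᶠ i in (ω : Filter ℕ), a i ∈ S i := Iff.rfl

lemma ultraSet_inter (S T : ∀ i, Set (X i)) :
    ultraSet ω S ∩ ultraSet ω T = ultraSet ω (fun i => S i ∩ T i) := by
  ext x
  obtain ⟨a, rfl⟩ := mk_surjective ω x
  simp only [Set.mem_inter_iff, mk_mem_ultraSet, eventually_and]

lemma ultraSet_union (S T : ∀ i, Set (X i)) :
    ultraSet ω S ∪ ultraSet ω T = ultraSet ω (fun i => S i ∪ T i) := by
  ext x
  obtain ⟨a, rfl⟩ := mk_surjective ω x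
  simp only [Set.mem_union, mk_mem_ultraSet, Ultrafilter.eventually_or]

lemma ultraSet_sdiff (S T : ∀ i, Set (X i)) :
    ultraSet ω S \ ultraSet ω T = ultraSet ω (fun i => S i \ T i) := by
  ext x
  obtain ⟨a, rfl⟩ := mk_surjective ω x
  simp only [Set.mem_sdiff, mk_mem_ultraSet, eventually_and, Ultrafilter.eventually_not]

lemma ultraSet_empty : ultraSet ω (fun i => (∅ : Set (X i))) = ∅ := by
  ext x
  obtain ⟨a, rfl⟩ := mk_surjective ω x
  simp [mk_mem_ultraSet, ω.neBot.ne]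

lemma ultraSet_univ : ultraSet ω (fun i => (Set.univ : Set (X i))) = Set.univ := by
  ext x
  obtain ⟨a, rfl⟩ := mk_surjective ω x
  simp [mk_mem_ultraSet]

/-- A containment of ultraproducts of sets holds coordinatewise `ω`-almost everywhere. -/
lemma eventually_subset_of_ultraSet_subset [∀ i, Nonempty (X i)] {S T : ∀ i, Set (X i)}
    (h : ultraSet ω S ⊆ ultraSet ω T) : ∀ᶠ i in (ω : Filter ℕ), S i ⊆ T i := by
  classical
  by_contra hc
  rw [← Ultrafilter.eventually_not] at hc
  have hx : ∀ i, ∃ a : X i, ¬ S i ⊆ T i → a ∈ S i ∧ a ∉ T i := by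
    intro i
    by_cases hi : S i ⊆ T i
    · exact ⟨Classical.arbitrary _, fun h' => absurd hi h'⟩
    · obtain ⟨a, h1, h2⟩ := Set.not_subset.1 hi
      exact ⟨a, fun _ => ⟨h1, h2⟩⟩
  choose a ha using hx
  have h1 : UltraProd.mk ω a ∈ ultraSet ω S :=
    (mk_mem_ultraSet ω S a).2 (hc.mono fun i hi => (ha i hi).1)
  have h2 := (mk_mem_ultraSet ω T a).1 (h h1)
  obtain ⟨i, hi, hi'⟩ := (hc.and h2).exists
  exact (ha i hi).2 hi'

lemma eventually_eq_of_ultraSet_eq [∀ i, Nonempty (X i)] {S T : ∀ i, Set (X i)}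
    (h : ultraSet ω S = ultraSet ω T) : ∀ᶠ i in (ω : Filter ℕ), S i = T i := by
  filter_upwards [eventually_subset_of_ultraSet_subset ω h.subset,
    eventually_subset_of_ultraSet_subset ω h.superset] with i h1 h2
  exact h1.antisymm h2

/-- Countable compactness: a countable cover of an ultraproduct of sets by ultraproducts of sets
has a finite subcover. -/
lemma exists_finite_subcover [∀ i, Nonempty (X i)] (hω : (ω : Filter ℕ) ≤ cofinite)
    {S : ℕ → ∀ i, Set (X i)} {T : ∀ i, Set (X i)}
    (h : ultraSet ω T ⊆ ⋃ n, ultraSet ω (S n)) :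
    ∃ N : ℕ, ∀ᶠ i in (ω : Filter ℕ), T i ⊆ ⋃ n ∈ Finset.range N, S n i := by
  classical
  by_contra hc
  push Not at hc
  have hx : ∀ i, ∃ a : X i, ∀ N ≤ i, (∀ M ≤ N, ¬ T i ⊆ ⋃ n ∈ Finset.range M, S n i) →
      a ∈ T i ∧ ∀ n < N, a ∉ S n i := by
    intro i
    induction i using Nat.strong_induction_on with
    | _ i _ =>
      set P : ℕ → Prop := fun N => ∀ M ≤ N, ¬ T i ⊆ ⋃ n ∈ Finset.range M, S n i with hP
      by_cases h0 : P 0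
      · have hb : P (Nat.findGreatest P i) := Nat.findGreatest_spec (Nat.zero_le i) h0
        obtain ⟨a, h1, h2⟩ := Set.not_subset.1 (hb _ le_rfl)
        refine ⟨a, fun N hN hPN => ⟨h1, fun n hn hmem => h2 ?_⟩⟩
        have hle : N ≤ Nat.findGreatest P i := Nat.le_findGreatest hN hPN
        simp only [Set.mem_iUnion, Finset.mem_range]
        exact ⟨n, hn.trans_le hle, hmem⟩
      · exact ⟨Classical.arbitrary _, fun N _ hPN =>
          absurd (fun M hM => hPN M (hM.trans (Nat.zero_le N))) h0⟩
  choose a ha using hx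
  have key : ∀ N, ∀ᶠ i in (ω : Filter ℕ), a i ∈ T i ∧ ∀ n < N, a i ∉ S n i := by
    intro N
    have h1 : ∀ᶠ i in (ω : Filter ℕ), N ≤ i := by
      apply hω
      rw [Nat.cofinite_eq_atTop]
      exact eventually_ge_atTop N
    have h2 : ∀ᶠ i in (ω : Filter ℕ), ∀ M ∈ Finset.range (N + 1),
        ¬ T i ⊆ ⋃ n ∈ Finset.range M, S n i := by
      rw [Filter.eventually_all_finset]
      intro M _
      exact hc M
    filter_upwards [h1, h2] with i hi hi2
    exact ha i N hi fun M hM => hi2 M (Finset.mem_range.2 (by omega))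
  have hT : UltraProd.mk ω a ∈ ultraSet ω T :=
    (mk_mem_ultraSet ω T a).2 ((key 0).mono fun i hi => hi.1)
  obtain ⟨n, hn⟩ := Set.mem_iUnion.1 (h hT)
  obtain ⟨i, hi, hi'⟩ := ((key (n + 1)).and ((mk_mem_ultraSet ω (S n) a).1 hn)).exists
  exact hi.2 n (Nat.lt_succ_self n) hi'

end Ultraproduct

/-! ### The group structure -/

section Group

variable (ω : Ultrafilter ℕ) (A : ℕ → Type u) [∀ i, CommGroup (A i)]

/-- Equality `ω`-almost everywhere as a congruence on the product group. -/
def ultraCon : Con (∀ i, A i) where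
  toSetoid := productSetoid (ω : Filter ℕ) A
  mul' := by
    intro a b c d h1 h2
    have h1' : ∀ᶠ i in (ω : Filter ℕ), a i = b i := h1
    have h2' : ∀ᶠ i in (ω : Filter ℕ), c i = d i := h2
    change ∀ᶠ i in (ω : Filter ℕ), (a * c) i = (b * d) i
    filter_upwards [h1', h2'] with i h3 h4
    simp [h3, h4]

/-- Coordinatewise group operations on the ultraproduct. -/
instance : CommGroup (UltraProd ω A) :=
  inferInstanceAs (CommGroup (ultraCon ω A).Quotient)

lemma mk_mul (a b : ∀ i, A i) :
    UltraProd.mk ω a * UltraProd.mk ω b = UltraProd.mk ω (a * b) := rfl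

end Group

/-! ### The `σ`-topology, Borel sets and the ultralimit measure -/

section Topology

variable (ω : Ultrafilter ℕ) {X : ℕ → Type u} [∀ i, TopologicalSpace (X i)]

/-- Strongly open sets: ultraproducts of open sets. -/
def IsStronglyOpen (S : Set (UltraProd ω X)) : Prop :=
  ∃ U : ∀ i, Set (X i), (∀ i, IsOpen (U i)) ∧ S = ultraSet ω U

/-- Open sets of the `σ`-topology: countable unions of strongly open sets. -/
def IsSigmaOpen (S : Set (UltraProd ω X)) : Prop :=
  ∃ U : ℕ → Set (UltraProd ω X), (∀ n, IsStronglyOpen ω (U n)) ∧ S = ⋃ n, U n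

/-- Continuity of a map from the ultraproduct to a topological space. -/
def SigmaContinuous {T : Type v} [TopologicalSpace T] (f : UltraProd ω X → T) : Prop :=
  ∀ V : Set T, IsOpen V → IsSigmaOpen ω (f ⁻¹' V)

lemma isSigmaOpen_iUnion {ι : Type*} [Countable ι] {S : ι → Set (UltraProd ω X)}
    (h : ∀ j, IsSigmaOpen ω (S j)) : IsSigmaOpen ω (⋃ j, S j) := by
  classical
  choose U hU hS using h
  rcases isEmpty_or_nonempty ι with hι | hι
  · refine ⟨fun _ => ∅, fun _ => ⟨fun _ => ∅, fun _ => isOpen_empty, (ultraSet_empty ω).symm⟩, ?_⟩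
    simp
  · obtain ⟨e, he⟩ := exists_surjective_nat (ι × ℕ)
    refine ⟨fun n => U (e n).1 (e n).2, fun n => hU _ _, ?_⟩
    ext x
    simp only [hS, Set.mem_iUnion]
    constructor
    · rintro ⟨j, n, hx⟩
      obtain ⟨k, hk⟩ := he (j, n)
      exact ⟨k, by rw [hk]; exact hx⟩
    · rintro ⟨k, hx⟩
      exact ⟨_, _, hx⟩

lemma isSigmaOpen_inter {S T : Set (UltraProd ω X)}
    (hS : IsSigmaOpen ω S) (hT : IsSigmaOpen ω T) : IsSigmaOpen ω (S ∩ T) := by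
  obtain ⟨U, hU, rfl⟩ := hS
  obtain ⟨V, hV, rfl⟩ := hT
  have : (⋃ n, U n) ∩ (⋃ n, V n) = ⋃ p : ℕ × ℕ, U p.1 ∩ V p.2 := by
    ext x
    simp only [Set.mem_inter_iff, Set.mem_iUnion, Prod.exists]
    constructor
    · rintro ⟨⟨m, hm⟩, n, hn⟩
      exact ⟨m, n, hm, hn⟩
    · rintro ⟨m, n, hm, hn⟩
      exact ⟨⟨m, hm⟩, n, hn⟩
  rw [this]
  refine isSigmaOpen_iUnion ω fun p => ⟨fun _ => U p.1 ∩ V p.2, fun _ => ?_, (Set.iUnion_const _).symm⟩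
  obtain ⟨u, hu, hu'⟩ := hU p.1
  obtain ⟨w, hw, hw'⟩ := hV p.2
  exact ⟨fun i => u i ∩ w i, fun i => (hu i).inter (hw i), by
    rw [hu', hw', ultraSet_inter]⟩

lemma isSigmaOpen_univ : IsSigmaOpen ω (Set.univ : Set (UltraProd ω X)) :=
  ⟨fun _ => Set.univ, fun _ => ⟨fun _ => Set.univ, fun _ => isOpen_univ,
    (ultraSet_univ ω).symm⟩, (Set.iUnion_const _).symm⟩

lemma isSigmaOpen_empty : IsSigmaOpen ω (∅ : Set (UltraProd ω X)) :=
  ⟨fun _ => ∅, fun _ => ⟨fun _ => ∅, fun _ => isOpen_empty, (ultraSet_empty ω).symm⟩, (Set.iUnion_const _).symm⟩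

/-- The Borel `σ`-algebra of the ultraproduct, generated by the strongly open sets. -/
instance : MeasurableSpace (UltraProd ω X) :=
  MeasurableSpace.generateFrom {S | IsStronglyOpen ω S}

end Topology

section Measure

variable (ω : Ultrafilter ℕ) {X : ℕ → Type u} [∀ i, MeasurableSpace (X i)]

/-- Ultraproducts of measurable sets. -/
def internalSets : Set (Set (UltraProd ω X)) :=
  {s | ∃ S : ∀ i, Set (X i), (∀ i, MeasurableSet (S i)) ∧ s = ultraSet ω S}

lemma isSetRing_internalSets : IsSetRing (internalSets ω (X := X)) where
  empty_mem := ⟨fun _ => ∅, fun _ => MeasurableSet.empty, (ultraSet_empty ω).symm⟩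
  union_mem := by
    rintro _ _ ⟨S, hS, rfl⟩ ⟨T, hT, rfl⟩
    exact ⟨_, fun i => (hS i).union (hT i), ultraSet_union ω S T⟩
  sdiff_mem := by
    rintro _ _ ⟨S, hS, rfl⟩ ⟨T, hT, rfl⟩
    exact ⟨_, fun i => (hS i).diff (hT i), ultraSet_sdiff ω S T⟩

lemma borel_le_generateFrom_internalSets [∀ i, TopologicalSpace (X i)]
    [∀ i, OpensMeasurableSpace (X i)] :
    (inferInstance : MeasurableSpace (UltraProd ω X)) ≤
      MeasurableSpace.generateFrom (internalSets ω (X := X)) := by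
  refine MeasurableSpace.generateFrom_mono ?_
  rintro _ ⟨U, hU, rfl⟩
  exact ⟨U, fun i => (hU i).measurableSet, rfl⟩

/-- The ultralimit of a sequence in the compact space `[0, ∞]`. -/
def ultraLim (a : ℕ → ℝ≥0∞) : ℝ≥0∞ := (ω.map a).lim

lemma tendsto_ultraLim (a : ℕ → ℝ≥0∞) : Tendsto a ω (𝓝 (ultraLim ω a)) :=
  (ω.map a).le_nhds_lim

variable (μ : ∀ i, Measure (X i))

open Classical in
/-- The set function `∏ S i ↦ lim μ i (S i)` on ultraproducts of measurable sets. -/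
def ultraContentFun (s : Set (UltraProd ω X)) : ℝ≥0∞ :=
  if h : s ∈ internalSets ω then ultraLim ω (fun i => μ i (h.choose i)) else 0

variable [∀ i, Nonempty (X i)]

lemma tendsto_ultraContentFun {S : ∀ i, Set (X i)} (hS : ∀ i, MeasurableSet (S i)) :
    Tendsto (fun i => μ i (S i)) ω (𝓝 (ultraContentFun ω μ (ultraSet ω S))) := by
  have h : ultraSet ω S ∈ internalSets ω := ⟨S, hS, rfl⟩
  have h' := eventually_eq_of_ultraSet_eq ω h.choose_spec.2
  rw [ultraContentFun, dif_pos h]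
  refine (tendsto_ultraLim ω _).congr' ?_
  filter_upwards [h'] with i hi
  rw [hi]

/-- The finitely additive content on ultraproducts of measurable sets. -/
def ultraContent : AddContent ℝ≥0∞ (internalSets ω (X := X)) :=
  IsSetRing.addContent_of_union (ultraContentFun ω μ) (isSetRing_internalSets ω)
    (by
      have h := tendsto_ultraContentFun ω μ (S := fun _ => ∅) (fun _ => MeasurableSet.empty)
      rw [ultraSet_empty] at h
      refine tendsto_nhds_unique h ?_
      simp)
    (by
      rintro _ _ ⟨S, hS, rfl⟩ ⟨T, hT, rfl⟩ hd
      rw [ultraSet_union]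
      refine tendsto_nhds_unique
        (tendsto_ultraContentFun ω μ fun i => (hS i).union (hT i))
        (((tendsto_ultraContentFun ω μ hS).add (tendsto_ultraContentFun ω μ hT)).congr' ?_)
      have h0 : ∀ᶠ i in (ω : Filter ℕ), S i ∩ T i = ∅ := by
        apply eventually_eq_of_ultraSet_eq ω (S := fun i => S i ∩ T i) (T := fun _ => ∅)
        rw [← ultraSet_inter, ultraSet_empty]
        exact Set.disjoint_iff_inter_eq_empty.1 hd
      filter_upwards [h0] with i hi
      exact (measure_union (Set.disjoint_iff_inter_eq_empty.2 hi) (hT i)).symm)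

lemma tendsto_ultraContent {S : ∀ i, Set (X i)} (hS : ∀ i, MeasurableSet (S i)) :
    Tendsto (fun i => μ i (S i)) ω (𝓝 (ultraContent ω μ (ultraSet ω S))) :=
  tendsto_ultraContentFun ω μ hS

lemma ultraContent_isSigmaSubadditive : (ultraContent ω μ).IsSigmaSubadditive := by
  classical
  intro s hs hU
  choose S hS hsS using hs
  obtain ⟨T, hT, hUT⟩ := hU
  have hsS' : s = fun n => ultraSet ω (S n) := funext hsS
  subst hsS'
  have hfin : ∀ N : ℕ, (∀ᶠ i in (ω : Filter ℕ), T i ⊆ ⋃ n ∈ Finset.range N, S n i) →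
      ultraContent ω μ (ultraSet ω T) ≤ ∑' n, ultraContent ω μ (ultraSet ω (S n)) := by
    intro N hN
    have h1 : Tendsto (fun i => ∑ n ∈ Finset.range N, μ i (S n i)) ω
        (𝓝 (∑ n ∈ Finset.range N, ultraContent ω μ (ultraSet ω (S n)))) :=
      tendsto_finsetSum _ fun n _ => tendsto_ultraContent ω μ (hS n)
    refine (le_of_tendsto_of_tendsto (tendsto_ultraContent ω μ hT) h1 ?_).trans
      (ENNReal.sum_le_tsum _)
    filter_upwards [hN] with i hi
    exact (measure_mono hi).trans (measure_biUnion_finset_le _ _)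
  rw [hUT]
  rcases ω.le_cofinite_or_eq_pure with hω | ⟨k, rfl⟩
  · obtain ⟨N, hN⟩ := exists_finite_subcover ω hω hUT.superset
    exact hfin N hN
  · have hsub : T k ⊆ ⋃ n, S n k := by
      intro x hx
      have hm : UltraProd.mk (pure k)
          (Function.update (fun i => Classical.arbitrary (X i)) k x) ∈
            ultraSet (pure k) T := by
        rw [mk_mem_ultraSet]
        simpa using hx
      rw [← hUT] at hm
      obtain ⟨n, hn⟩ := Set.mem_iUnion.1 hm
      rw [mk_mem_ultraSet] at hn
      exact Set.mem_iUnion.2 ⟨n, by simpa using hn⟩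
    have hval : ∀ R : ∀ i, Set (X i), (∀ i, MeasurableSet (R i)) →
        ultraContent (pure k) μ (ultraSet (pure k) R) = μ k (R k) := by
      intro R hR
      refine tendsto_nhds_unique (tendsto_ultraContent (pure k) μ hR) ?_
      simpa using tendsto_pure_nhds (fun i => μ i (R i)) k
    rw [hval T hT]
    simp_rw [fun n => hval (S n) (hS n)]
    exact (measure_mono hsub).trans (measure_iUnion_le _)

/-- The measure on the `σ`-algebra generated by the ultraproducts of measurable sets. -/
def internalMeasure : Measure[MeasurableSpace.generateFrom (internalSets ω (X := X))]
    (UltraProd ω X) :=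
  @AddContent.measure _ _ (MeasurableSpace.generateFrom (internalSets ω (X := X)))
    (ultraContent ω μ) (isSetRing_internalSets ω).isSetSemiring le_rfl
    (ultraContent_isSigmaSubadditive ω μ)

lemma internalMeasure_eq {s : Set (UltraProd ω X)} (hs : s ∈ internalSets ω) :
    internalMeasure ω μ s = ultraContent ω μ s :=
  @AddContent.measure_eq _ _ _ (MeasurableSpace.generateFrom (internalSets ω (X := X)))
    (ultraContent ω μ) (isSetRing_internalSets ω).isSetSemiring rfl
    (ultraContent_isSigmaSubadditive ω μ) hs

variable [∀ i, TopologicalSpace (X i)] [∀ i, OpensMeasurableSpace (X i)]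

/-- The ultralimit measure on the Borel sets of the ultraproduct. -/
def ultraMeasure : Measure (UltraProd ω X) :=
  (internalMeasure ω μ).trim (borel_le_generateFrom_internalSets ω)

/-- The ultralimit measure of a strongly open set `∏ U i` is `lim μ i (U i)`. -/
lemma tendsto_ultraMeasure {U : ∀ i, Set (X i)} (hU : ∀ i, IsOpen (U i)) :
    Tendsto (fun i => μ i (U i)) ω (𝓝 (ultraMeasure ω μ (ultraSet ω U))) := by
  have hm : MeasurableSet (ultraSet ω U) :=
    MeasurableSpace.measurableSet_generateFrom ⟨U, hU, rfl⟩
  have h := tendsto_ultraContent ω μ fun i => (hU i).measurableSet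
  have hval : ultraMeasure ω μ (ultraSet ω U) = ultraContent ω μ (ultraSet ω U) :=
    (trim_measurableSet_eq (borel_le_generateFrom_internalSets ω) hm).trans
      (internalMeasure_eq ω μ ⟨U, fun i => (hU i).measurableSet, rfl⟩)
  rwa [hval]

instance [∀ i, IsProbabilityMeasure (μ i)] : IsProbabilityMeasure (ultraMeasure ω μ) := by
  refine ⟨?_⟩
  have h := tendsto_ultraMeasure ω μ (U := fun _ => Set.univ) fun _ => isOpen_univ
  rw [ultraSet_univ] at h
  refine tendsto_nhds_unique h ?_
  simp

end Measure

/-! ### Compact abelian groups -/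

/-- The normalized Haar measure of a compact group. -/
def haarProb (G : Type u) [Group G] [TopologicalSpace G] [IsTopologicalGroup G]
    [CompactSpace G] [MeasurableSpace G] [BorelSpace G] : Measure G :=
  Measure.haarMeasure ⊤

instance (G : Type u) [Group G] [TopologicalSpace G] [IsTopologicalGroup G]
    [CompactSpace G] [MeasurableSpace G] [BorelSpace G] : IsProbabilityMeasure (haarProb G) :=
  ⟨Measure.haarMeasure_self (K₀ := (⊤ : TopologicalSpace.PositiveCompacts G))⟩

/-- Second countable compact (Hausdorff) abelian groups, written multiplicatively, with their
Borel `σ`-algebra. -/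
structure CompAb : Type (v + 1) where
  carrier : Type v
  [commGroup : CommGroup carrier]
  [topologicalSpace : TopologicalSpace carrier]
  [isTopologicalGroup : IsTopologicalGroup carrier]
  [compactSpace : CompactSpace carrier]
  [t2Space : T2Space carrier]
  [secondCountable : SecondCountableTopology carrier]
  [measurableSpace : MeasurableSpace carrier]
  [borelSpace : BorelSpace carrier]

instance : CoeSort CompAb.{v} (Type v) := ⟨CompAb.carrier⟩

attribute [instance] CompAb.commGroup CompAb.topologicalSpace CompAb.isTopologicalGroup
  CompAb.compactSpace CompAb.t2Space CompAb.secondCountable CompAb.measurableSpace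
  CompAb.borelSpace

/-- `L²` functions on second countable compact abelian groups. -/
structure L2Fun : Type (v + 1) where
  grp : CompAb.{v}
  toFun : grp → ℂ
  memLp : MemLp toFun 2 (haarProb grp)

/-- A bounded measurable function on a second countable compact abelian group, as an `L²`
function. -/
def L2Fun.ofLinfty (B : CompAb.{v}) (h : B → ℂ) (hh : MemLp h ⊤ (haarProb B)) : L2Fun.{v} :=
  ⟨B, h, hh.mono_exponent le_top⟩

/-- The Fourier transform of a function on a compact abelian group. -/
def L2Fun.fourier (g : L2Fun.{v}) (χ : PontryaginDual g.grp) : ℂ :=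
  ∫ x, g.toFun x * conj (χ x : ℂ) ∂(haarProb g.grp)

/-- Isomorphism of `L²` functions on compact abelian groups: both factor, almost everywhere, over
the same function on a common quotient by continuous epimorphisms. -/
def L2Fun.Iso (g₁ g₂ : L2Fun.{v}) : Prop :=
  ∃ (g₃ : L2Fun.{v}) (α₁ : g₁.grp →* g₃.grp) (α₂ : g₂.grp →* g₃.grp),
    Continuous α₁ ∧ Function.Surjective α₁ ∧ Continuous α₂ ∧ Function.Surjective α₂ ∧
    (∀ᵐ x ∂(haarProb g₁.grp), g₃.toFun (α₁ x) = g₁.toFun x) ∧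
    (∀ᵐ x ∂(haarProb g₂.grp), g₃.toFun (α₂ x) = g₂.toFun x)

/-- The isomorphism class of an `L²` function on a compact abelian group. -/
def L2Fun.isoClass (g : L2Fun.{v}) : Set L2Fun.{v} := {g' | g'.Iso g}

/-! ### Functions on discrete groups -/

section Discrete

variable {G₁ : Type u} {G₂ : Type v} [Group G₁] [Group G₂]

/-- Isomorphism of functions on discrete groups: a value preserving isomorphism between the
subgroups generated by the supports. -/
def DiscreteIso (f₁ : G₁ → ℂ) (f₂ : G₂ → ℂ) : Prop :=
  ∃ α : Subgroup.closure (Function.support f₁) ≃* Subgroup.closure (Function.support f₂),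
    ∀ x : Subgroup.closure (Function.support f₁), f₁ x = f₂ (α x)

/-- Partial isomorphisms of weight `n` between subsets of two groups. -/
def IsPartialIso (n : ℕ) {S₁ : Set G₁} {S₂ : Set G₂} (φ : S₁ ≃ S₂) : Prop :=
  ∀ (g : Fin n → S₁) (α : Fin n → ℤ), (∀ i, α i = -1 ∨ α i = 0 ∨ α i = 1) →
    ((List.ofFn fun i => (g i : G₁) ^ α i).prod = 1 ↔
      (List.ofFn fun i => (φ (g i) : G₂) ^ α i).prod = 1)

/-- Existence of an `ε`-isomorphism between two functions on discrete groups. -/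
def EpsIso (ε : ℝ) (f₁ : G₁ → ℂ) (f₂ : G₂ → ℂ) : Prop :=
  ∃ (S₁ : Set G₁) (S₂ : Set G₂) (φ : S₁ ≃ S₂),
    IsPartialIso ⌈1 / ε⌉₊ φ ∧ {g | ε < ‖f₁ g‖} ⊆ S₁ ∧ {g | ε < ‖f₂ g‖} ⊆ S₂ ∧
    ∀ g : S₁, ‖f₁ g - f₂ (φ g)‖ ≤ ε

/-- The distance `d̂` of functions on discrete groups: the infimum of all `ε > 0` that admit an
`ε`-isomorphism. -/
def discreteDist (f₁ : G₁ → ℂ) (f₂ : G₂ → ℂ) : ℝ≥0∞ :=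
  ⨅ (ε : ℝ) (_ : 0 < ε) (_ : EpsIso ε f₁ f₂), ENNReal.ofReal ε

end Discrete

/-- The distance `d` of `L²` functions on compact abelian groups. -/
def L2Fun.dist (g₁ g₂ : L2Fun.{v}) : ℝ≥0∞ := discreteDist g₁.fourier g₂.fourier

/-! ### Fourier analysis on ultraproducts of compact abelian groups -/

section UltraFourier

variable (ω : Ultrafilter ℕ) (A : ℕ → Type u) [∀ i, CommGroup (A i)]
  [∀ i, TopologicalSpace (A i)]

/-- The group of linear characters of the ultraproduct: homomorphisms to the unit circle that are
continuous in the `σ`-topology. -/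
def ultraDual : Subgroup (UltraProd ω A →* Circle) where
  carrier := {χ | SigmaContinuous ω χ}
  one_mem' := by
    intro V _
    by_cases h : (1 : Circle) ∈ V
    · convert isSigmaOpen_univ ω using 1
      ext x
      simpa using h
    · convert isSigmaOpen_empty ω using 1
      ext x
      simpa using h
  mul_mem' := by
    intro χ ψ hχ hψ V hV
    have hW : IsOpen {p : Circle × Circle | p.1 * p.2 ∈ V} :=
      hV.preimage (continuous_fst.mul continuous_snd)
    set B := TopologicalSpace.countableBasis Circle
    have hB := TopologicalSpace.isBasis_countableBasis Circle
    have hBc : B.Countable := TopologicalSpace.countable_countableBasis Circle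
    let I := {q : B × B // (q.1 : Set Circle) ×ˢ (q.2 : Set Circle) ⊆
      {p : Circle × Circle | p.1 * p.2 ∈ V}}
    have : Countable B := hBc.to_subtype
    have hI : Countable I := inferInstance
    have heq : (χ * ψ : UltraProd ω A →* Circle) ⁻¹' V =
        ⋃ q : I, (χ ⁻¹' (q.1.1 : Set Circle)) ∩ (ψ ⁻¹' (q.1.2 : Set Circle)) := by
      ext x
      simp only [Set.mem_preimage, MonoidHom.mul_apply, Set.mem_iUnion, Set.mem_inter_iff]
      constructor
      · intro hx
        have hx' : (χ x, ψ x) ∈ {p : Circle × Circle | p.1 * p.2 ∈ V} := hx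
        obtain ⟨s, hs, hxs, hsub⟩ := (hB.prod hB).exists_subset_of_mem_open hx' hW
        obtain ⟨s₁, h₁, s₂, h₂, rfl⟩ := hs
        exact ⟨⟨(⟨s₁, h₁⟩, ⟨s₂, h₂⟩), hsub⟩, hxs.1, hxs.2⟩
      · rintro ⟨q, h1, h2⟩
        exact q.2 (Set.mk_mem_prod h1 h2)
    rw [heq]
    exact isSigmaOpen_iUnion ω fun q => isSigmaOpen_inter ω
      (hχ _ (hB.isOpen q.1.1.2)) (hψ _ (hB.isOpen q.1.2.2))
  inv_mem' := by
    intro χ hχ V hV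
    exact hχ _ (hV.preimage continuous_inv)

/-- The Fourier `σ`-algebra, generated by the linear characters. -/
@[reducible] def fourierSigma : MeasurableSpace (UltraProd ω A) :=
  ⨆ χ : ultraDual ω A, MeasurableSpace.comap (fun x => (χ.1 x : ℂ)) (borel ℂ)

variable [∀ i, IsTopologicalGroup (A i)] [∀ i, CompactSpace (A i)]
  [∀ i, MeasurableSpace (A i)] [∀ i, BorelSpace (A i)]

/-- The ultralimit of the normalized Haar measures. -/
def ultraHaar : Measure (UltraProd ω A) := ultraMeasure ω fun i => haarProb (A i)

instance : IsProbabilityMeasure (ultraHaar ω A) :=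
  inferInstanceAs (IsProbabilityMeasure (ultraMeasure ω fun i => haarProb (A i)))

variable {A}

/-- The Fourier transform of a function on the ultraproduct. -/
def ultraFourier (f : UltraProd ω A → ℂ) (χ : ultraDual ω A) : ℂ :=
  ∫ x, f x * conj (χ.1 x : ℂ) ∂(ultraHaar ω A)

/-- `𝒬(f)`: the class of the `L²` functions on second countable compact abelian groups whose
Fourier transform is isomorphic to the Fourier transform of `f`. -/
def classQ (f : UltraProd ω A → ℂ) : Set L2Fun.{v} :=
  {g | DiscreteIso g.fourier (ultraFourier ω f)}

/-- `f = h ∘ φ` almost everywhere, where `φ` is a continuous surjective measure preserving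
homomorphism onto `B` and `h ∈ L^∞(B)`. -/
structure IsFactorization (f : UltraProd ω A → ℂ) (B : CompAb.{v}) (φ : UltraProd ω A →* B)
    (h : B → ℂ) : Prop where
  continuous : SigmaContinuous ω φ
  surjective : Function.Surjective φ
  measurePreserving : MeasurePreserving φ (ultraHaar ω A) (haarProb B)
  memLp : MemLp h ⊤ (haarProb B)
  ae_eq : f =ᵐ[ultraHaar ω A] h ∘ φ

end UltraFourier

end UltraFourier

end

open UltraFourier

/-! A function measurable in the Fourier σ-algebra involves only countably many linear characters: ℂ
is second countable, and every set of a generated σ-algebra uses countably many generators. Together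
these characters map the ultraproduct into a countable power of the circle. As ω is non-principal,
the σ-topology is countably compact, so continuous maps to metrizable spaces are closed
(`isClosed_image_of_sigmaContinuous`). The image is therefore a compact group B, and the function
factors through it by Doob–Dynkin. The ultralimit measure is translation invariant, so it pushes
forward to Haar measure on B. Conversely, the Borel sets of B are generated by the characters of B,
which pull back to linear characters.

Now let f = h ∘ φ almost everywhere. A character nontrivial on ker φ has zero coefficient in f:
translation by a kernel element multiplies the integrand by a constant other than 1. Every other
linear character descends to B, and is continuous there because φ is closed. So the transform of f
is that of h extended by zero (`discreteIso_fourier_comp`), and the two are isomorphic. Isomorphic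
transforms are at distance 0, since a group isomorphism preserves all words.

It remains that functions on compact groups are isomorphic exactly when their transforms are. One
direction is extension by zero again. For the other (`iso_of_discreteIso`), the group Γ generated by
the support evaluates both compact groups into the torus of maps from Γ to the circle. The two
images of Haar measure have the same character integrals, so they agree; hence so do the closed
images, which give a common quotient, and both functions descend to the same function on it.

The underlying Fourier analysis needs characters to separate points. This comes from the spectral
theorem for compact self-adjoint convolution operators; Stone–Weierstrass then makes the characters
a Hilbert basis. -/

noncomputable section

set_option linter.unusedSectionVars false

namespace UltraFourier

section SeparatingCharacters

/-! ### Characters of a compact abelian group separate points -/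

/-- A commuting family of endomorphisms has a joint eigenvector in every nonzero finite-dimensional
invariant subspace. -/
lemma exists_joint_eigenvector {H ι : Type*} [AddCommGroup H] [Module ℂ H] (U : ι → H →ₗ[ℂ] H)
    (hU : ∀ i j v, U i (U j v) = U j (U i v)) (V : Submodule ℂ H) [FiniteDimensional ℂ V]
    (hV : V ≠ ⊥) (hinv : ∀ i, ∀ v ∈ V, U i v ∈ V) :
    ∃ v ∈ V, v ≠ 0 ∧ ∀ i, ∃ c : ℂ, U i v = c • v := by
  induction hn : Module.finrank ℂ V using Nat.strong_induction_on generalizing V with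
  | _ n ih =>
    -- If every operator is scalar on V, any nonzero vector works. Otherwise an eigenspace of a
    -- non-scalar one is a proper, nonzero, invariant subspace by commutativity, and the dimension
    -- drops.
    by_cases hs : ∀ i, ∃ c : ℂ, ∀ v ∈ V, U i v = c • v
    · obtain ⟨v, hv, hv0⟩ := Submodule.exists_mem_ne_zero_of_ne_bot hV
      exact ⟨v, hv, hv0, fun i => (hs i).imp fun c hc => hc v hv⟩
    · push Not at hs
      obtain ⟨i, hi⟩ := hs
      have : Nontrivial V := Submodule.nontrivial_iff_ne_bot.2 hV
      obtain ⟨c, hc⟩ := Module.End.exists_eigenvalue ((U i).restrict (hinv i))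
      obtain ⟨⟨w, hwV⟩, hw⟩ := hc.exists_hasEigenvector
      have hw1 : U i w = c • w := congrArg Subtype.val hw.apply_eq_smul
      have hw0 : w ≠ 0 := fun h => hw.2 (Subtype.ext h)
      let V' : Submodule ℂ H := V ⊓ Module.End.eigenspace (U i) c
      have hle : V' ≤ V := inf_le_left
      have hlt : V' < V := by
        refine lt_of_le_of_ne hle fun h => ?_
        obtain ⟨v, hv, hv'⟩ := hi c
        rw [← h] at hv
        exact hv' (Module.End.mem_eigenspace_iff.1 hv.2)
      have : FiniteDimensional ℂ V' := Submodule.finiteDimensional_of_le hle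
      obtain ⟨v, hv, h⟩ := ih _ (hn ▸ Submodule.finrank_lt_finrank_of_lt hlt) V'
        (fun h => hw0 ((Submodule.mem_bot ℂ).1 (h ▸ ⟨hwV, Module.End.mem_eigenspace_iff.2 hw1⟩)))
        (fun j v hv => ⟨hinv j v hv.1, Module.End.mem_eigenspace_iff.2 (by
          rw [hU i j, Module.End.mem_eigenspace_iff.1 hv.2, map_smul])⟩) rfl
      exact ⟨v, hle hv, h⟩

section HaarInstances

variable {G : Type u} [Group G] [TopologicalSpace G] [IsTopologicalGroup G] [CompactSpace G]
  [MeasurableSpace G] [BorelSpace G]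

instance : (haarProb G).IsHaarMeasure :=
  inferInstanceAs (Measure.haarMeasure (⊤ : TopologicalSpace.PositiveCompacts G)).IsHaarMeasure

instance : (haarProb G).Regular :=
  inferInstanceAs (Measure.haarMeasure (⊤ : TopologicalSpace.PositiveCompacts G)).Regular

end HaarInstances

/-! ### Translations and convolution operators on L²(G) -/

variable {G : Type u} [CommGroup G] [TopologicalSpace G] [IsTopologicalGroup G] [CompactSpace G]
  [T2Space G] [SecondCountableTopology G] [MeasurableSpace G] [BorelSpace G]

/-- Translation by `x` on `L²(G)`. -/
def translate (x : G) : Lp ℂ 2 (haarProb G) →ₗᵢ[ℂ] Lp ℂ 2 (haarProb G) :=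
  Lp.compMeasurePreservingₗᵢ ℂ (x * ·) (measurePreserving_mul_left (haarProb G) x)

lemma coeFn_translate (x : G) (f : Lp ℂ 2 (haarProb G)) :
    translate x f =ᵐ[haarProb G] fun y => f (x * y) :=
  Lp.coeFn_compMeasurePreserving _ _

lemma translate_translate (x y : G) (f : Lp ℂ 2 (haarProb G)) :
    translate x (translate y f) = translate (x * y) f := by
  -- The domain action composes in the opposite order, which commutativity absorbs.
  change DomMulAct.mk x • DomMulAct.mk y • f = DomMulAct.mk (x * y) • f
  rw [smul_smul, ← DomMulAct.mk_mul, mul_comm x y]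

lemma translate_one (f : Lp ℂ 2 (haarProb G)) : translate 1 f = f := by
  change DomMulAct.mk (1 : G) • f = f
  rw [DomMulAct.mk_one, one_smul]

lemma continuous_translate (f : Lp ℂ 2 (haarProb G)) : Continuous fun x : G => translate x f := by
  have : Fact ((2 : ℝ≥0∞) ≠ ∞) := ⟨by simp⟩
  change Continuous fun x : G => DomMulAct.mk x • f
  exact DomMulAct.continuous_mk.smul continuous_const

open scoped InnerProductSpace in
/-- Convolution with `w`, as an operator from `L²(G)` to continuous functions. -/
def convOp (w : Lp ℂ 2 (haarProb G)) :
    Lp ℂ 2 (haarProb G) →L[ℂ] BoundedContinuousFunction G ℂ :=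
  LinearMap.mkContinuous
    { toFun := fun f => BoundedContinuousFunction.mkOfCompact
        ⟨fun x => ⟪translate x⁻¹ w, f⟫_ℂ,
          ((continuous_translate w).comp continuous_inv).inner continuous_const⟩
      map_add' := fun f g => by ext x; simp [inner_add_right]
      map_smul' := fun c f => by ext x; simp [inner_smul_right] } ‖w‖ (fun f => by
        refine (BoundedContinuousFunction.norm_le (by positivity)).2 fun x => ?_
        refine (norm_inner_le_norm (𝕜 := ℂ) (translate x⁻¹ w) f).trans ?_
        rw [LinearIsometry.norm_map])

open scoped InnerProductSpace in
lemma convOp_apply (w f : Lp ℂ 2 (haarProb G)) (x : G) :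
    convOp w f x = ⟪translate x⁻¹ w, f⟫_ℂ := rfl

/-- Arzelà–Ascoli: on the unit ball the values are bounded by ‖w‖, and equicontinuity follows from
the L²-continuity of the translates of w. -/
lemma isCompactOperator_convOp (w : Lp ℂ 2 (haarProb G)) : IsCompactOperator (convOp w) := by
  refine (isCompactOperator_iff_isCompact_closure_image_ball (convOp w).toLinearMap one_pos).2 ?_
  refine BoundedContinuousFunction.arzela_ascoli (Metric.closedBall (0 : ℂ) ‖w‖)
    (isCompact_closedBall _ _) _ ?_ ?_
  · rintro _ x ⟨f, hf, rfl⟩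
    rw [mem_closedBall_zero_iff]
    refine (norm_inner_le_norm (𝕜 := ℂ) (translate x⁻¹ w) f).trans ?_
    rw [LinearIsometry.norm_map]
    have : ‖f‖ < 1 := by simpa using hf
    nlinarith [norm_nonneg w]
  · intro x
    rw [Metric.equicontinuousAt_iff_right]
    intro ε hε
    have hc := ((continuous_translate w).comp continuous_inv).continuousAt (x := x)
    filter_upwards [Metric.tendsto_nhds.1 hc ε hε] with y hy
    rintro ⟨_, f, hf, rfl⟩
    have hf1 : ‖f‖ < 1 := by simpa using hf
    change dist (convOp w f x) (convOp w f y) < ε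
    rw [dist_comm, dist_eq_norm, convOp_apply, convOp_apply, ← inner_sub_left]
    refine (norm_inner_le_norm (𝕜 := ℂ) _ _).trans_lt ?_
    rw [dist_eq_norm] at hy
    refine lt_of_le_of_lt ?_ hy
    exact mul_le_of_le_one_right (norm_nonneg _) hf1.le

/-- Convolution with `w` on `L²(G)`. -/
def convL2 (w : Lp ℂ 2 (haarProb G)) : Lp ℂ 2 (haarProb G) →L[ℂ] Lp ℂ 2 (haarProb G) :=
  (BoundedContinuousFunction.toLp 2 (haarProb G) ℂ).comp (convOp w)

lemma coeFn_convL2 (w f : Lp ℂ 2 (haarProb G)) : convL2 w f =ᵐ[haarProb G] convOp w f :=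
  BoundedContinuousFunction.coeFn_toLp _ _ _ (convOp w f)

lemma isCompactOperator_convL2 (w : Lp ℂ 2 (haarProb G)) : IsCompactOperator (convL2 w) :=
  (isCompactOperator_convOp w).clm_comp (BoundedContinuousFunction.toLp 2 (haarProb G) ℂ)

lemma convL2_translate (w f : Lp ℂ 2 (haarProb G)) (g : G) :
    convL2 w (translate g f) = translate g (convL2 w f) := by
  refine Lp.ext ?_
  have h := (measurePreserving_mul_left (haarProb G) g).quasiMeasurePreserving.ae_eq_comp
    (coeFn_convL2 w f)
  filter_upwards [coeFn_convL2 w (translate g f), coeFn_translate g (convL2 w f), h]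
    with x h1 h2 h3
  rw [h1, h2]
  refine Eq.trans ?_ h3.symm
  change convOp w _ x = convOp w f (g * x)
  rw [convOp_apply, convOp_apply, ← LinearIsometry.inner_map_map (translate g) (translate (g * x)⁻¹ w),
    translate_translate]
  simp

open scoped InnerProductSpace in
-- The integral kernel k(x⁻¹y) is real and symmetric in x and y, so Fubini exchanges the two sides.
lemma isSymmetric_convL2 (k : C(G, ℝ)) (hk : ∀ x, k x⁻¹ = k x) (w : Lp ℂ 2 (haarProb G))
    (hw : w =ᵐ[haarProb G] fun x => (k x : ℂ)) : (convL2 w).toLinearMap.IsSymmetric := by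
  have hconv : ∀ f x, convOp w f x = ∫ y, (k (x⁻¹ * y) : ℂ) * f y ∂(haarProb G) := by
    intro f x
    rw [convOp_apply, L2.inner_def]
    refine integral_congr_ae ?_
    have h := (measurePreserving_mul_left (haarProb G) x⁻¹).quasiMeasurePreserving.ae_eq_comp hw
    filter_upwards [coeFn_translate x⁻¹ w, h] with y h1 h2
    have h2' : w (x⁻¹ * y) = k (x⁻¹ * y) := h2
    rw [h1, h2', RCLike.inner_apply, Complex.conj_ofReal, mul_comm]
  intro f h
  change ⟪convL2 w f, h⟫_ℂ = ⟪f, convL2 w h⟫_ℂ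
  have hint : ∀ f : Lp ℂ 2 (haarProb G), Integrable f (haarProb G) := fun f =>
    (Lp.memLp f).integrable one_le_two
  have h1 : ⟪convL2 w f, h⟫_ℂ =
      ∫ x, ∫ y, h x * ((k (x⁻¹ * y) : ℂ) * conj (f y)) ∂(haarProb G) ∂(haarProb G) := by
    rw [L2.inner_def]
    refine integral_congr_ae ?_
    filter_upwards [coeFn_convL2 w f] with x hx
    rw [hx, RCLike.inner_apply, hconv, ← integral_conj, ← integral_const_mul]
    simp
  have h2 : ⟪f, convL2 w h⟫_ℂ =
      ∫ y, ∫ x, h x * ((k (x⁻¹ * y) : ℂ) * conj (f y)) ∂(haarProb G) ∂(haarProb G) := by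
    rw [L2.inner_def]
    refine integral_congr_ae ?_
    filter_upwards [coeFn_convL2 w h] with y hy
    rw [hy, RCLike.inner_apply, hconv, ← integral_mul_const]
    refine integral_congr_ae (Eventually.of_forall fun x => ?_)
    have : k (y⁻¹ * x) = k (x⁻¹ * y) := by rw [← hk]; simp
    simp only [this]
    ring
  rw [h1, h2]
  refine integral_integral_swap ?_
  have hb : Integrable (fun p : G × G => h p.1 * conj (f p.2)) ((haarProb G).prod (haarProb G)) :=
    (hint h).mul_prod (Complex.conjLIE.toContinuousLinearEquiv.toContinuousLinearMap.integrable_comp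
      (hint f))
  refine (hb.bdd_mul (f := fun p : G × G => (k (p.1⁻¹ * p.2) : ℂ)) (c := ‖k‖) ?_ ?_).congr ?_
  · exact (by fun_prop : Continuous fun p : G × G => (k (p.1⁻¹ * p.2) : ℂ)).aestronglyMeasurable
  · refine Eventually.of_forall fun p => ?_
    rw [Complex.norm_real]
    exact k.norm_coe_le_norm _
  · refine Eventually.of_forall fun p => ?_
    simp only [Function.uncurry]
    ring

open scoped InnerProductSpace in
/-- A joint eigenvector of the translations yields a continuous character. -/
lemma exists_character_of_joint_eigenvector (f : Lp ℂ 2 (haarProb G)) (hf : f ≠ 0)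
    (h : ∀ x : G, ∃ c : ℂ, translate x f = c • f) :
    ∃ χ : PontryaginDual G, ∀ x, translate x f = (χ x : ℂ) • f := by
  choose c hc using h
  have hinj : ∀ a b : ℂ, a • f = b • f → a = b := fun a b hab => smul_left_injective ℂ hf hab
  have hnorm : ∀ x, ‖c x‖ = 1 := by
    intro x
    have h1 : ‖translate x f‖ = ‖f‖ := LinearIsometry.norm_map _ _
    rw [hc, norm_smul] at h1
    exact mul_right_cancel₀ (norm_ne_zero_iff.2 hf) (h1.trans (one_mul _).symm)
  have hmul : ∀ x y, c (x * y) = c x * c y := by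
    intro x y
    apply hinj
    rw [← hc, ← translate_translate, hc y, map_smul, hc x, smul_smul, mul_comm]
  have hone : c 1 = 1 := hinj _ _ (by rw [← hc, translate_one, one_smul])
  have hcont : Continuous c := by
    -- The eigenvalue is recovered by pairing with f, so it inherits continuity from the translation
    -- action.
    have : c = fun x => (⟪f, f⟫_ℂ)⁻¹ * ⟪f, translate x f⟫_ℂ := by
      ext x
      have h0 : ⟪f, f⟫_ℂ ≠ 0 := inner_self_ne_zero.2 hf
      rw [hc, inner_smul_right]
      field_simp
    rw [this]
    exact continuous_const.mul (continuous_const.inner (continuous_translate f))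
  let χ : G →ₜ* Circle :=
    { toFun := fun x => ⟨c x, mem_sphere_zero_iff_norm.2 (hnorm x)⟩
      map_one' := Subtype.ext hone
      map_mul' := fun x y => Subtype.ext (hmul x y)
      continuous_toFun := hcont.subtype_mk _ }
  exact ⟨χ, hc⟩

/-- Translation by an element that all characters annihilate is trivial on the eigenspaces of a
convolution operator. -/
lemma translate_eq_self_of_mem_eigenspace (g : G) (hg : ∀ χ : PontryaginDual G, χ g = 1)
    (w : Lp ℂ 2 (haarProb G)) {c : ℂ} (hc : c ≠ 0) {f : Lp ℂ 2 (haarProb G)}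
    (hf : f ∈ Module.End.eigenspace (convL2 w).toLinearMap c) : translate g f = f := by
  set E := Module.End.eigenspace (convL2 w).toLinearMap c with hE
  have : FiniteDimensional ℂ E :=
    ContinuousLinearMap.finite_dimensional_eigenspace (isCompactOperator_convL2 w) c hc
  have hinv : ∀ x : G, ∀ v ∈ E, translate x v ∈ E := by
    intro x v hv
    rw [hE, Module.End.mem_eigenspace_iff] at hv ⊢
    have hv' : convL2 w v = c • v := hv
    change convL2 w (translate x v) = _
    rw [convL2_translate, hv', map_smul]
  -- If D were nonzero on E, its image D(E) would contain a joint eigenvector D u, fixed by g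
  -- because its character is trivial at g. Then g ^ n moves u by n • D u, which is unbounded,
  -- although translations are isometries.
  let D : Lp ℂ 2 (haarProb G) →ₗ[ℂ] Lp ℂ 2 (haarProb G) := (translate g).toLinearMap - LinearMap.id
  have hD : ∀ v, D v = translate g v - v := fun v => rfl
  have hcomm : ∀ (x y : G) v, translate x (translate y v) = translate y (translate x v) := by
    intro x y v
    rw [translate_translate, translate_translate, mul_comm]
  by_contra hne
  have hV : E.map D ≠ ⊥ := by
    intro h
    have h1 : D f ∈ E.map D := ⟨f, hf, rfl⟩
    rw [h, Submodule.mem_bot, hD, sub_eq_zero] at h1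
    exact hne h1
  obtain ⟨_, ⟨u, hu, rfl⟩, hv0, hv⟩ := exists_joint_eigenvector
    (fun x : G => (translate x).toLinearMap) hcomm (E.map D) hV (by
      rintro x _ ⟨v, hv, rfl⟩
      refine ⟨translate x v, hinv x v hv, ?_⟩
      change translate g (translate x v) - translate x v = translate x (translate g v - v)
      rw [map_sub, hcomm])
  obtain ⟨χ, hχ⟩ := exists_character_of_joint_eigenvector (D u) hv0 hv
  have h1 : translate g (D u) = D u := by rw [hχ, hg]; simp
  have h2 : ∀ n : ℕ, translate (g ^ n) u = u + n • D u := by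
    intro n
    induction n with
    | zero => simp [translate_one]
    | succ n ih =>
      have h3 : translate g u = u + D u := by rw [hD]; abel
      rw [pow_succ', ← translate_translate, ih, map_add, map_nsmul, h1, h3, add_smul, one_smul]
      abel
  have h4 : ∀ n : ℕ, n * ‖D u‖ ≤ 2 * ‖u‖ := by
    intro n
    have h5 : (n : ℂ) • D u = translate (g ^ n) u - u := by
      rw [h2, Nat.cast_smul_eq_nsmul]; abel
    have h6 := congrArg norm h5
    rw [norm_smul, Complex.norm_natCast] at h6
    rw [h6, two_mul]
    refine (norm_sub_le _ _).trans ?_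
    rw [LinearIsometry.norm_map]
  obtain ⟨n, hn⟩ := exists_nat_gt (2 * ‖u‖ / ‖D u‖)
  rw [div_lt_iff₀ (norm_pos_iff.2 hv0)] at hn
  exact absurd (h4 n) (not_le.2 hn)

open scoped InnerProductSpace in
/-- Continuous characters separate the points of a compact abelian group. -/
theorem exists_character_ne_one (g : G) (hg : g ≠ 1) : ∃ χ : PontryaginDual G, χ g ≠ 1 := by
  by_contra! hall
  obtain ⟨φ, hφ0, hφ1, -⟩ := exists_continuous_zero_one_of_isClosed (s := {g}) (t := {(1 : G)})
    isClosed_singleton isClosed_singleton (by simpa using hg)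
  -- Symmetrizing the Urysohn function makes the convolution self-adjoint while k still separates 1
  -- from g.
  let k : C(G, ℝ) := ⟨fun x => φ x * φ x⁻¹, by fun_prop⟩
  have hk : ∀ x, k x⁻¹ = k x := fun x => by simp [k, mul_comm]
  have hk1 : k 1 = 1 := by simp [k, hφ1 rfl]
  have hkg : k g = 0 := by simp [k, hφ0 rfl]
  let kc : BoundedContinuousFunction G ℂ := BoundedContinuousFunction.mkOfCompact
    ⟨fun x => (k x : ℂ), by fun_prop⟩
  let w : Lp ℂ 2 (haarProb G) := BoundedContinuousFunction.toLp 2 (haarProb G) ℂ kc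
  have hw : w =ᵐ[haarProb G] fun x => (k x : ℂ) :=
    BoundedContinuousFunction.coeFn_toLp _ _ _ kc
  have hsym := isSymmetric_convL2 k hk w hw
  let D : Lp ℂ 2 (haarProb G) →L[ℂ] Lp ℂ 2 (haarProb G) :=
    (translate g).toContinuousLinearMap - ContinuousLinearMap.id ℂ _
  have hD : ∀ v, D v = translate g v - v := fun v => rfl
  -- The composite of D and the convolution kills all eigenvectors: for c ≠ 0 because g acts
  -- trivially, for c = 0 because convolution commutes with translation. Eigenvectors span densely,
  -- so the composite is zero.
  have hker : (⨆ c, Module.End.eigenspace (convL2 w).toLinearMap c) ≤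
      ((convL2 w).comp D).toLinearMap.ker := by
    refine iSup_le fun c v hv => ?_
    rw [LinearMap.mem_ker]
    change convL2 w (translate g v - v) = 0
    by_cases hc : c = 0
    · have hv' : convL2 w v = 0 := by
        have := Module.End.mem_eigenspace_iff.1 hv
        rw [hc, zero_smul] at this
        exact this
      rw [map_sub, convL2_translate, hv', map_zero, sub_zero]
    · rw [translate_eq_self_of_mem_eigenspace g hall w hc hv, sub_self, map_zero]
  have hTD : ∀ v, convL2 w (D v) = 0 := by
    intro v
    have hbot := ContinuousLinearMap.orthogonalComplement_iSup_eigenspaces_eq_bot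
      (isCompactOperator_convL2 w) hsym
    have htop := (Submodule.topologicalClosure_eq_top_iff).2 hbot
    have hcl : IsClosed (((convL2 w).comp D).toLinearMap.ker : Set (Lp ℂ 2 (haarProb G))) :=
      ((convL2 w).comp D).isClosed_ker
    have hle := Submodule.topologicalClosure_minimal _ hker hcl
    rw [htop] at hle
    exact hle (Submodule.mem_top (x := v))
  -- The convolution is a continuous function, so vanishing in L² means vanishing everywhere; its
  -- value at 1 is this inner product. Hence w is invariant under g, which forces k 1 = k g.
  have hz : ∀ v, ⟪w, D v⟫_ℂ = 0 := by
    intro v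
    have h1 : convOp w (D v) =ᵐ[haarProb G] fun _ => (0 : ℂ) := by
      filter_upwards [coeFn_convL2 w (D v), Lp.coeFn_zero ℂ 2 (haarProb G)] with x h1 h2
      rw [← h1, hTD, h2]; rfl
    have h2 := (Continuous.ae_eq_iff_eq (haarProb G) (convOp w (D v)).continuous
      continuous_const).1 h1
    have h3 := congrFun h2 1
    rwa [convOp_apply, inv_one, translate_one] at h3
  have hwg : translate g⁻¹ w = w := by
    rw [← sub_eq_zero, ← inner_self_eq_zero (𝕜 := ℂ)]
    set v := translate g⁻¹ w - w
    rw [inner_sub_left, ← LinearIsometry.inner_map_map (translate g) (translate g⁻¹ w),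
      translate_translate, mul_inv_cancel, translate_one, ← inner_sub_right, ← hD, hz]
  have h1 : (fun x => (k (g⁻¹ * x) : ℂ)) =ᵐ[haarProb G] fun x => (k x : ℂ) := by
    have h := (measurePreserving_mul_left (haarProb G) g⁻¹).quasiMeasurePreserving.ae_eq_comp hw
    have h' := coeFn_translate g⁻¹ w
    rw [hwg] at h'
    filter_upwards [hw, h, h'] with x h2 h3 h4
    rw [← h2, h4]
    exact h3.symm
  have h2 := (Continuous.ae_eq_iff_eq (haarProb G) (by fun_prop) (by fun_prop)).1 h1
  have h3 := congrFun h2 g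
  simp [hk1, hkg] at h3

end SeparatingCharacters

section FourierSeries

/-! ### Fourier series on compact abelian groups -/

/-- Substituting T shows that the integral equals c times itself. -/
lemma integral_eq_zero_of_semiinvariant {X : Type*} [MeasurableSpace X] {μ : Measure X} {T : X → X}
    (hT : MeasurePreserving T μ μ) {F : X → ℂ} {c : ℂ} (hc : c ≠ 1)
    (h : ∀ x, F (T x) = c * F x) : ∫ x, F x ∂μ = 0 := by
  by_cases hF : AEStronglyMeasurable F μ
  · have h1 : ∫ x, F (T x) ∂μ = ∫ x, F x ∂μ := by
      rw [← integral_map hT.measurable.aemeasurable (by rwa [hT.map_eq]), hT.map_eq]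
    simp_rw [h, integral_const_mul] at h1
    have h2 : (c - 1) * ∫ x, F x ∂μ = 0 := by rw [sub_mul, h1, one_mul, sub_self]
    exact (mul_eq_zero.1 h2).resolve_left (sub_ne_zero.2 hc)
  -- The integral of a non-measurable function is 0 by convention, so no measurability hypothesis is
  -- needed.
  · exact integral_non_aestronglyMeasurable hF

variable {G : Type u} [CommGroup G] [TopologicalSpace G] [IsTopologicalGroup G] [CompactSpace G]
  [T2Space G]

/-- A continuous character as a complex valued continuous function. -/
def charMap (χ : PontryaginDual G) : C(G, ℂ) :=
  ⟨fun x => (χ x : ℂ), continuous_subtype_val.comp (map_continuous χ)⟩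

lemma charMap_apply (χ : PontryaginDual G) (x : G) : charMap χ x = (χ x : ℂ) := rfl

lemma dual_mul_apply (χ ψ : PontryaginDual G) (x : G) : (χ * ψ) x = χ x * ψ x := rfl

lemma dual_inv_apply (χ : PontryaginDual G) (x : G) : χ⁻¹ x = (χ x)⁻¹ := rfl

/-- The span of a group of characters, as a star subalgebra of the continuous functions. -/
def charSubalgebra (D : Subgroup (PontryaginDual G)) : StarSubalgebra ℂ C(G, ℂ) where
  toSubalgebra := Algebra.adjoin ℂ (charMap '' (D : Set (PontryaginDual G)))
  star_mem' := by
    change Algebra.adjoin ℂ (charMap '' (D : Set (PontryaginDual G))) ≤ star (Algebra.adjoin ℂ (charMap '' (D : Set (PontryaginDual G))))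
    refine Algebra.adjoin_le ?_
    rintro - ⟨χ, hχ, rfl⟩
    refine Algebra.subset_adjoin ⟨χ⁻¹, D.inv_mem hχ, ?_⟩
    ext x
    change ((χ x)⁻¹ : ℂ) = conj (χ x : ℂ)
    rw [← Circle.coe_inv, Circle.coe_inv_eq_conj]

/-- The characters in D are closed under products, so linear combinations already form an algebra.
-/
lemma charSubalgebra_toSubmodule (D : Subgroup (PontryaginDual G)) :
    Subalgebra.toSubmodule (charSubalgebra D).toSubalgebra = Submodule.span ℂ (charMap '' (D : Set (PontryaginDual G))) := by
  apply Algebra.adjoin_eq_span_of_subset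
  refine Subset.trans ?_ Submodule.subset_span
  intro x hx
  refine Submonoid.closure_induction (fun _ => id) ⟨1, D.one_mem, ?_⟩ ?_ hx
  · ext x; simp [charMap_apply]
  · rintro - - - - ⟨χ, hχ, rfl⟩ ⟨ψ, hψ, rfl⟩
    refine ⟨χ * ψ, D.mul_mem hχ hψ, ?_⟩
    ext x; simp [charMap_apply, dual_mul_apply]

lemma charSubalgebra_separatesPoints (D : Subgroup (PontryaginDual G))
    (hD : ∀ x y : G, x ≠ y → ∃ χ ∈ D, χ x ≠ χ y) : (charSubalgebra D).SeparatesPoints := by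
  intro x y hxy
  obtain ⟨χ, hχ, h⟩ := hD x y hxy
  exact ⟨_, ⟨charMap χ, Algebra.subset_adjoin ⟨χ, hχ, rfl⟩, rfl⟩, fun h' => h (Subtype.ext h')⟩

section Countable

variable [SecondCountableTopology G]

instance : Countable (PontryaginDual G) := by
  have : SecondCountableTopology (PontryaginDual G) :=
    (ContinuousMonoidHom.isInducing_toContinuousMap G Circle).secondCountableTopology
  -- The dual of a compact group is discrete, and a separable discrete space is countable.
  exact TopologicalSpace.separableSpace_iff_countable.1 inferInstance

end Countable

variable [SecondCountableTopology G] [MeasurableSpace G] [BorelSpace G]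

/-- Finite measures with equal integrals of the members of a separating group of characters are
equal. -/
lemma measure_ext_of_characters (D : Subgroup (PontryaginDual G))
    (hD : ∀ x y : G, x ≠ y → ∃ χ ∈ D, χ x ≠ χ y) (μ ν : Measure G) [IsFiniteMeasure μ]
    [IsFiniteMeasure ν] (h : ∀ χ ∈ D, ∫ x, (χ x : ℂ) ∂μ = ∫ x, (χ x : ℂ) ∂ν) : μ = ν := by
  have : PolishSpace G := by
    let := TopologicalSpace.metrizableSpaceMetric G
    infer_instance
  let A : StarSubalgebra ℂ (BoundedContinuousFunction G ℂ) :=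
    (charSubalgebra D).comap (BoundedContinuousFunction.toContinuousMapStarₐ ℂ)
  refine ext_of_forall_mem_subalgebra_integral_eq_of_polish (𝕜 := ℂ) (A := A) ?_ ?_
  · intro x y hxy
    obtain ⟨_, ⟨F, hF, rfl⟩, h⟩ := charSubalgebra_separatesPoints D hD hxy
    exact ⟨_, ⟨F, ⟨BoundedContinuousFunction.mkOfCompact F, hF, rfl⟩, rfl⟩, h⟩
  · have key : ∀ F ∈ Submodule.span ℂ (charMap '' (D : Set (PontryaginDual G))),
        ∫ x, F x ∂μ = ∫ x, F x ∂ν := by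
      intro F hF
      have hi : ∀ (F : C(G, ℂ)) (μ : Measure G) [IsFiniteMeasure μ], Integrable F μ := fun F μ _ =>
        F.continuous.integrable_of_hasCompactSupport (HasCompactSupport.of_compactSpace _)
      induction hF using Submodule.span_induction with
      | mem F hF => obtain ⟨χ, hχ, rfl⟩ := hF; exact h χ hχ
      | zero => simp
      | add F F' _ _ h1 h2 =>
        simp only [ContinuousMap.add_apply]
        rw [integral_add (hi _ _) (hi _ _), integral_add (hi _ _) (hi _ _), h1, h2]
      | smul c F _ h1 =>
        simp only [ContinuousMap.smul_apply, integral_smul, h1]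
    intro F hF
    refine key F.toContinuousMap ?_
    rw [← charSubalgebra_toSubmodule]
    exact hF

lemma separating_dual (x y : G) (hxy : x ≠ y) : ∃ χ : PontryaginDual G, χ x ≠ χ y := by
  obtain ⟨χ, hχ⟩ := exists_character_ne_one (x * y⁻¹) (fun h => hxy (mul_inv_eq_one.1 h))
  refine ⟨χ, fun h => hχ ?_⟩
  rw [map_mul, map_inv, h, mul_inv_cancel]

lemma integral_character (χ : PontryaginDual G) [Decidable (χ = 1)] :
    ∫ x, (χ x : ℂ) ∂(haarProb G) = if χ = 1 then 1 else 0 := by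
  split_ifs with h
  · subst h; simp
  · obtain ⟨a, ha⟩ : ∃ a, χ a ≠ 1 := by
      by_contra! h'
      exact h (PontryaginDual.ext h')
    refine integral_eq_zero_of_semiinvariant (measurePreserving_mul_left (haarProb G) a)
      (c := (χ a : ℂ)) (fun h' => ha (Subtype.ext h')) fun x => ?_
    rw [map_mul, Circle.coe_mul]

/-- A continuous character as an element of `L²`. -/
def charLp (χ : PontryaginDual G) : Lp ℂ 2 (haarProb G) :=
  ContinuousMap.toLp 2 (haarProb G) ℂ (charMap χ)

lemma coeFn_charLp (χ : PontryaginDual G) : charLp χ =ᵐ[haarProb G] fun x => (χ x : ℂ) :=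
  ContinuousMap.coeFn_toLp (haarProb G) (charMap χ)

open scoped InnerProductSpace in
lemma inner_charLp (χ : PontryaginDual G) (g : G → ℂ) (hg : MemLp g 2 (haarProb G)) :
    ⟪charLp χ, hg.toLp g⟫_ℂ = ∫ x, g x * conj (χ x : ℂ) ∂(haarProb G) := by
  rw [L2.inner_def]
  refine integral_congr_ae ?_
  filter_upwards [coeFn_charLp χ, hg.coeFn_toLp] with x h1 h2
  rw [h1, h2, RCLike.inner_apply]

lemma orthonormal_charLp : Orthonormal ℂ (charLp (G := G)) := by
  classical
  rw [orthonormal_iff_ite]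
  intro χ ψ
  rw [charLp, charLp, ContinuousMap.inner_toLp]
  have h : ∀ x : G, charMap ψ x * conj (charMap χ x) = ((ψ * χ⁻¹) x : ℂ) := by
    intro x
    rw [dual_mul_apply, dual_inv_apply, Circle.coe_mul, Circle.coe_inv_eq_conj]; rfl
  simp_rw [h, integral_character, mul_inv_eq_one]
  exact if_congr eq_comm rfl rfl

/-- Stone–Weierstrass gives uniform density in the continuous functions, and these are dense in L².
-/
lemma span_charLp : ⊤ ≤ (Submodule.span ℂ (range (charLp (G := G)))).topologicalClosure := by
  have h1 : (Submodule.span ℂ (range (charMap (G := G)))).topologicalClosure = ⊤ := by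
    have h2 := charSubalgebra_toSubmodule (⊤ : Subgroup (PontryaginDual G))
    rw [Subgroup.coe_top, image_univ] at h2
    rw [← h2]
    exact congrArg (Subalgebra.toSubmodule <| StarSubalgebra.toSubalgebra ·)
      (ContinuousMap.starSubalgebra_topologicalClosure_eq_top_of_separatesPoints
        (charSubalgebra (⊤ : Subgroup (PontryaginDual G)))
        (charSubalgebra_separatesPoints _ fun x y hxy =>
          (separating_dual x y hxy).imp fun χ h => ⟨Subgroup.mem_top χ, h⟩))
  have h3 := (ContinuousMap.toLp_denseRange ℂ (haarProb G) ℂ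
    (p := 2) (by simp)).topologicalClosure_map_submodule h1
  rw [Submodule.map_span, ← range_comp] at h3
  exact h3.ge

/-- The characters form a Hilbert basis of `L²`. -/
def charBasis : HilbertBasis (PontryaginDual G) ℂ (Lp ℂ 2 (haarProb G)) :=
  HilbertBasis.mk orthonormal_charLp span_charLp

/-- A closed subspace of `L²` containing the characters at which the Fourier transform of `g` does
not vanish contains `g`. -/
lemma mem_of_charLp_mem {g : G → ℂ} (hg : MemLp g 2 (haarProb G))
    (K : Submodule ℂ (Lp ℂ 2 (haarProb G))) (hK : IsClosed (K : Set (Lp ℂ 2 (haarProb G))))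
    (h : ∀ χ : PontryaginDual G, ∫ x, g x * conj (χ x : ℂ) ∂(haarProb G) ≠ 0 → charLp χ ∈ K) :
    hg.toLp g ∈ K := by
  refine hK.mem_of_tendsto (charBasis.hasSum_repr (hg.toLp g))
    (Eventually.of_forall fun s => K.sum_mem fun χ _ => ?_)
  rw [HilbertBasis.repr_apply_apply]
  have hb : charBasis χ = charLp χ := by rw [charBasis, HilbertBasis.coe_mk]
  rw [hb, inner_charLp]
  by_cases h0 : ∫ x, g x * conj (χ x : ℂ) ∂(haarProb G) = 0
  · rw [h0, zero_smul]; exact K.zero_mem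
  · exact K.smul_mem _ (h χ h0)

/-- Uniqueness of Fourier series. -/
lemma ae_eq_of_fourier_eq {g h : G → ℂ} (hg : MemLp g 2 (haarProb G)) (hh : MemLp h 2 (haarProb G))
    (he : ∀ χ : PontryaginDual G, ∫ x, g x * conj (χ x : ℂ) ∂(haarProb G) =
      ∫ x, h x * conj (χ x : ℂ) ∂(haarProb G)) : g =ᵐ[haarProb G] h := by
  rw [← hg.toLp_eq_toLp_iff hh]
  apply charBasis.repr.injective
  ext χ
  have hb : charBasis χ = charLp χ := by rw [charBasis, HilbertBasis.coe_mk]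
  rw [HilbertBasis.repr_apply_apply, HilbertBasis.repr_apply_apply, hb, inner_charLp, inner_charLp,
    he]

/-- The Borel `σ`-algebra is generated by the characters. -/
lemma borel_le_iSup_comap_characters : (inferInstance : MeasurableSpace G) ≤
    ⨆ χ : PontryaginDual G, MeasurableSpace.comap (fun x => (χ x : ℂ)) (borel ℂ) := by
  let F : G → (PontryaginDual G → ℂ) := fun x χ => (χ x : ℂ)
  have hF : Continuous F := continuous_pi fun χ => (charMap χ).continuous
  have hinj : Function.Injective F := by
    intro x y hxy
    by_contra hne
    obtain ⟨χ, hχ⟩ := separating_dual x y hne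
    exact hχ (Subtype.ext (congrFun hxy χ))
  -- Countability of the dual matters here: it makes the product σ-algebra on the target the Borel
  -- one.
  have hemb := (hF.isClosedEmbedding hinj).measurableEmbedding
  rw [← hemb.comap_eq, MeasurableSpace.pi, MeasurableSpace.comap_iSup]
  simp_rw [MeasurableSpace.comap_comp]
  refine iSup_mono fun χ => ?_
  rw [BorelSpace.measurable_eq (α := ℂ)]
  exact le_rfl

end FourierSeries

/-! ### Isomorphisms of functions on discrete groups -/

section Discrete

variable {G₁ G₂ G₃ : Type*} [Group G₁] [Group G₂] [Group G₃]

lemma DiscreteIso.symm {f₁ : G₁ → ℂ} {f₂ : G₂ → ℂ} (h : DiscreteIso f₁ f₂) : DiscreteIso f₂ f₁ := by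
  obtain ⟨α, hα⟩ := h
  exact ⟨α.symm, fun x => by rw [hα, MulEquiv.apply_symm_apply]⟩

lemma DiscreteIso.trans {f₁ : G₁ → ℂ} {f₂ : G₂ → ℂ} {f₃ : G₃ → ℂ} (h : DiscreteIso f₁ f₂)
    (h' : DiscreteIso f₂ f₃) : DiscreteIso f₁ f₃ := by
  obtain ⟨α, hα⟩ := h
  obtain ⟨β, hβ⟩ := h'
  exact ⟨α.trans β, fun x => by rw [hα, hβ]; rfl⟩

/-- A function is isomorphic to its extension by zero along an injective homomorphism. -/
lemma DiscreteIso.of_injective {f₁ : G₁ → ℂ} {f₂ : G₂ → ℂ} (i : G₁ →* G₂)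
    (hi : Function.Injective i) (hf : ∀ x, f₂ (i x) = f₁ x) (hs : ∀ y, f₂ y ≠ 0 → ∃ x, i x = y) :
    DiscreteIso f₁ f₂ := by
  have himg : i '' Function.support f₁ = Function.support f₂ := by
    ext y
    constructor
    · rintro ⟨x, hx, rfl⟩
      rwa [Function.mem_support, hf]
    · intro hy
      obtain ⟨x, rfl⟩ := hs y hy
      exact ⟨x, by rwa [Function.mem_support, ← hf], rfl⟩
  have hcl : (Subgroup.closure (Function.support f₁)).map i =
      Subgroup.closure (Function.support f₂) := by rw [MonoidHom.map_closure, himg]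
  exact ⟨((Subgroup.closure (Function.support f₁)).equivMapOfInjective i hi).trans
    (MulEquiv.subgroupCongr hcl), fun x => (hf x).symm⟩

lemma discreteDist_eq_zero_of_discreteIso {f₁ : G₁ → ℂ} {f₂ : G₂ → ℂ} (h : DiscreteIso f₁ f₂) :
    discreteDist f₁ f₂ = 0 := by
  obtain ⟨α, hα⟩ := h
  have heps : ∀ ε : ℝ, 0 < ε → EpsIso ε f₁ f₂ := by
    intro ε hε
    -- For every ε the sets S₁ and S₂ are the whole subgroups generated by the supports.
    refine ⟨_, _, α.toEquiv, ?_, ?_, ?_, ?_⟩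
    · intro g a _
      have h1 : (List.ofFn fun i => (g i : G₁) ^ a i).prod =
          ((List.ofFn fun i => g i ^ a i).prod : Subgroup.closure (Function.support f₁)) := by
        rw [SubmonoidClass.coe_list_prod, List.map_ofFn]; rfl
      have h2 : (List.ofFn fun i => (α (g i) : G₂) ^ a i).prod =
          (α (List.ofFn fun i => g i ^ a i).prod : Subgroup.closure (Function.support f₂)) := by
        rw [map_list_prod, List.map_ofFn, SubmonoidClass.coe_list_prod, List.map_ofFn]
        congr 2
        ext i
        simp
      change _ ↔ (List.ofFn fun i => (α (g i) : G₂) ^ a i).prod = 1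
      rw [h1, h2, OneMemClass.coe_eq_one, OneMemClass.coe_eq_one, EmbeddingLike.map_eq_one_iff]
    · intro x hx
      exact Subgroup.subset_closure (norm_pos_iff.1 (hε.trans hx))
    · intro x hx
      exact Subgroup.subset_closure (norm_pos_iff.1 (hε.trans hx))
    · intro x
      change ‖f₁ x - f₂ (α x)‖ ≤ ε
      rw [hα, sub_self, norm_zero]
      exact hε.le
  refine le_antisymm (ENNReal.le_of_forall_pos_le_add fun ε hε _ => ?_) zero_le
  rw [zero_add]
  refine iInf_le_of_le ε (iInf_le_of_le hε (iInf_le_of_le (heps ε hε) ?_))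
  simp

end Discrete

/-! ### Pushforwards along epimorphisms -/

section Pushforward

variable {X : Type*} [CommGroup X] [MeasurableSpace X] {μ : Measure X}
  {G : Type v} [CommGroup G] [TopologicalSpace G] [IsTopologicalGroup G] [CompactSpace G]
  [T2Space G] [SecondCountableTopology G] [MeasurableSpace G] [BorelSpace G]

/-- Translation by a fixes h ∘ φ and multiplies the conjugate character by a constant other than 1.
-/
lemma integral_comp_mul_conj_eq_zero (hμ : ∀ a : X, MeasurePreserving (a * ·) μ μ) (φ : X →* G)
    (h : G → ℂ) (χ : X →* Circle) {a : X} (ha : φ a = 1) (hχ : χ a ≠ 1) :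
    ∫ x, h (φ x) * conj (χ x : ℂ) ∂μ = 0 := by
  refine integral_eq_zero_of_semiinvariant (hμ a) (c := conj (χ a : ℂ)) (fun h' => hχ ?_)
    fun x => ?_
  · exact Subtype.ext ((starRingEnd ℂ).injective (h'.trans (map_one _).symm))
  · rw [map_mul, map_mul, ha, one_mul, Circle.coe_mul, map_mul]
    ring

lemma integral_comp_mul_conj {φ : X → G} (hφ : MeasurePreserving φ μ (haarProb G)) {h : G → ℂ}
    (hh : AEStronglyMeasurable h (haarProb G)) (ψ : PontryaginDual G) :
    ∫ x, h (φ x) * conj (ψ (φ x) : ℂ) ∂μ = ∫ y, h y * conj (ψ y : ℂ) ∂(haarProb G) := by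
  rw [← hφ.map_eq, integral_map hφ.measurable.aemeasurable]
  rw [hφ.map_eq]
  exact hh.mul (Complex.continuous_conj.comp (charMap ψ).continuous).aestronglyMeasurable

/-- Surjectivity makes every translation of G the image of one of X, so the pushforward is an
invariant probability measure, and Haar measure is unique. -/
lemma measurePreserving_of_surjective [IsProbabilityMeasure μ]
    (hμ : ∀ a : X, MeasurePreserving (a * ·) μ μ) (φ : X →* G) (hφ : Measurable φ)
    (hs : Function.Surjective φ) : MeasurePreserving φ μ (haarProb G) := by
  refine ⟨hφ, ?_⟩
  have : IsProbabilityMeasure (μ.map φ) := Measure.isProbabilityMeasure_map hφ.aemeasurable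
  have : (μ.map φ).IsMulLeftInvariant := by
    refine ⟨fun g => ?_⟩
    obtain ⟨a, rfl⟩ := hs g
    rw [Measure.map_map (measurable_const_mul _) hφ]
    have : (φ a * ·) ∘ φ = φ ∘ (a * ·) := by
      ext x; simp
    rw [this, ← Measure.map_map hφ (hμ a).measurable, (hμ a).map_eq]
  have h := Measure.haarMeasure_unique (μ.map φ) (⊤ : TopologicalSpace.PositiveCompacts G)
  rw [TopologicalSpace.PositiveCompacts.coe_top, measure_univ, one_smul] at h
  exact h

/-- The Fourier transform of a pulled back function is the extension by zero of the Fourier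
transform, for every group of characters `D` in which every character vanishing on the kernel comes
from the quotient. -/
lemma discreteIso_fourier_comp (D : Subgroup (X →* Circle))
    (hμ : ∀ a : X, MeasurePreserving (a * ·) μ μ) (φ : X →* G) (hs : Function.Surjective φ)
    (hφ : MeasurePreserving φ μ (haarProb G)) {h : G → ℂ}
    (hh : AEStronglyMeasurable h (haarProb G))
    (hD : ∀ ψ : PontryaginDual G, (ψ : G →* Circle).comp φ ∈ D)
    (hD' : ∀ ψ : G →* Circle, ψ.comp φ ∈ D → Continuous ψ) {f : X → ℂ} (hf : f =ᵐ[μ] h ∘ φ) :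
    DiscreteIso (fun ψ : PontryaginDual G => ∫ y, h y * conj (ψ y : ℂ) ∂(haarProb G))
      (fun χ : D => ∫ x, f x * conj (χ.1 x : ℂ) ∂μ) := by
  have hf' : ∀ χ : X →* Circle, ∫ x, f x * conj (χ x : ℂ) ∂μ = ∫ x, h (φ x) * conj (χ x : ℂ) ∂μ :=
    fun χ => integral_congr_ae (hf.mono fun x hx => by simp only [hx, Function.comp_apply])
  let i : PontryaginDual G →* D :=
    { toFun := fun ψ => ⟨(ψ : G →* Circle).comp φ, hD ψ⟩
      map_one' := rfl
      map_mul' := fun _ _ => rfl }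
  refine DiscreteIso.of_injective i ?_ ?_ ?_
  · intro ψ ψ' h
    refine PontryaginDual.ext fun y => ?_
    obtain ⟨x, rfl⟩ := hs y
    exact DFunLike.congr_fun (congrArg Subtype.val h) x
  · intro ψ
    simp only [hf']
    exact integral_comp_mul_conj hφ hh ψ
  · intro χ hχ
    -- A nonzero coefficient forces χ to be trivial on ker φ, so χ descends to the quotient.
    have hker : φ.ker ≤ χ.1.ker := by
      intro a ha
      by_contra hne
      refine hχ ?_
      simp only [hf']
      exact integral_comp_mul_conj_eq_zero hμ φ h χ.1 ha hne
    let ψ : G →* Circle := φ.liftOfSurjective hs ⟨χ.1, hker⟩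
    have hψ : ψ.comp φ = χ.1 := MonoidHom.liftOfRightInverse_comp _ _ _ _
    refine ⟨(⟨ψ, hD' ψ (hψ ▸ χ.2)⟩ : G →ₜ* Circle), Subtype.ext ?_⟩
    exact hψ

end Pushforward

/-! ### Isomorphic functions on compact abelian groups -/

section Compact

variable {G : Type u} [CommGroup G] [TopologicalSpace G] [IsTopologicalGroup G] [CompactSpace G]
  [T2Space G] [SecondCountableTopology G] [MeasurableSpace G] [BorelSpace G]
  {K : Type v} [CommGroup K] [TopologicalSpace K] [IsTopologicalGroup K] [CompactSpace K]
  [T2Space K] [SecondCountableTopology K] [MeasurableSpace K] [BorelSpace K]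

lemma continuous_of_comp_surjective {α : G → K} (hα : Continuous α) (hs : Function.Surjective α)
    {Z : Type*} [TopologicalSpace Z] {ψ : K → Z} (h : Continuous (ψ ∘ α)) : Continuous ψ :=
  (hα.isClosedMap.isQuotientMap hα hs).continuous_iff.2 h

lemma measurePreserving_epi (α : G →* K) (hα : Continuous α) (hs : Function.Surjective α) :
    MeasurePreserving α (haarProb G) (haarProb K) :=
  measurePreserving_of_surjective (measurePreserving_mul_left _) α hα.measurable hs

lemma discreteIso_fourier_of_epi (α : G →* K) (hα : Continuous α) (hs : Function.Surjective α)
    {g : G → ℂ} {k : K → ℂ} (hk : AEStronglyMeasurable k (haarProb K))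
    (h : ∀ᵐ x ∂(haarProb G), k (α x) = g x) :
    DiscreteIso (fun ψ : PontryaginDual K => ∫ y, k y * conj (ψ y : ℂ) ∂(haarProb K))
      (fun χ : PontryaginDual G => ∫ x, g x * conj (χ x : ℂ) ∂(haarProb G)) := by
  -- A copy of the Pontryagin dual inside the abstract homomorphisms, the form shared with the dual
  -- of the ultraproduct.
  let D : Subgroup (G →* Circle) :=
    { carrier := {χ | Continuous χ}
      one_mem' := continuous_const
      mul_mem' := fun {χ ψ} hχ hψ => Continuous.mul (f := χ) (g := ψ) hχ hψ
      inv_mem' := fun {χ} hχ => Continuous.inv (f := χ) hχ }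
  let i : PontryaginDual G →* D :=
    { toFun := fun χ => ⟨(χ : G →* Circle), map_continuous χ⟩
      map_one' := rfl
      map_mul' := fun _ _ => rfl }
  refine (discreteIso_fourier_comp D (measurePreserving_mul_left _) α hs
    (measurePreserving_epi α hα hs) hk (fun ψ => (map_continuous ψ).comp hα)
    (fun ψ hψ => continuous_of_comp_surjective hα hs hψ)
    (f := g) (h.mono fun x hx => hx.symm)).trans (DiscreteIso.symm ?_)
  refine DiscreteIso.of_injective i ?_ (fun _ => rfl) ?_
  · intro χ ψ h
    exact PontryaginDual.ext fun x => DFunLike.congr_fun (congrArg Subtype.val h) x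
  · exact fun χ _ => ⟨(⟨χ.1, χ.2⟩ : G →ₜ* Circle), rfl⟩

end Compact

lemma discreteIso_of_iso {g₁ g₂ : L2Fun.{v}} (h : g₁.Iso g₂) :
    DiscreteIso g₁.fourier g₂.fourier := by
  obtain ⟨g₃, α₁, α₂, hc₁, hs₁, hc₂, hs₂, h₁, h₂⟩ := h
  exact (discreteIso_fourier_of_epi α₁ hc₁ hs₁ g₃.memLp.1 h₁).symm.trans
    (discreteIso_fourier_of_epi α₂ hc₂ hs₂ g₃.memLp.1 h₂)

/-! ### Evaluation into tori and common quotients -/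

section Evaluation

instance : MeasurableSpace Circle := borel Circle

instance : BorelSpace Circle := ⟨rfl⟩

variable {G : Type u} [CommGroup G] [TopologicalSpace G] [IsTopologicalGroup G] [CompactSpace G]
  [T2Space G] [SecondCountableTopology G] [MeasurableSpace G] [BorelSpace G]
  {Γ : Type v} [Group Γ]

/-- The homomorphism into a torus whose coordinates are a family of characters. -/
def evalHom (p : Γ →* PontryaginDual G) : G →* (Γ → Circle) where
  toFun x γ := p γ x
  map_one' := by ext γ; simp
  map_mul' x y := by ext γ; simp

lemma continuous_evalHom (p : Γ →* PontryaginDual G) : Continuous (evalHom p) :=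
  continuous_pi fun γ => map_continuous (p γ)

/-- The coordinate characters of a torus. -/
def coordChar (γ : Γ) : PontryaginDual (Γ → Circle) :=
  (⟨Pi.evalMonoidHom _ γ, continuous_apply γ⟩ : (Γ → Circle) →ₜ* Circle)

/-- The characters of a torus generated by the coordinates restrict to `Γ` on the image of
`evalHom`. -/
lemma exists_eq_of_mem_closure_coordChar {H : Type*} [CommGroup H] [TopologicalSpace H]
    [IsTopologicalGroup H] (p : Γ →* PontryaginDual G) (q : Γ →* PontryaginDual H)
    {ξ : PontryaginDual (Γ → Circle)} (hξ : ξ ∈ Subgroup.closure (range (coordChar (Γ := Γ)))) :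
    ∃ γ, (∀ x, ξ (evalHom p x) = p γ x) ∧
      ∀ y, ξ (fun γ' => q γ' y) = q γ y := by
  induction hξ using Subgroup.closure_induction with
  | mem ξ hξ => obtain ⟨γ, rfl⟩ := hξ; exact ⟨γ, fun _ => rfl, fun _ => rfl⟩
  | one => exact ⟨1, fun x => by simp, fun y => by simp⟩
  | mul ξ ξ' _ _ h1 h2 =>
    obtain ⟨γ, h1, h1'⟩ := h1
    obtain ⟨γ', h2, h2'⟩ := h2
    refine ⟨γ * γ', fun x => ?_, fun y => ?_⟩
    · rw [dual_mul_apply, h1, h2, map_mul]; rfl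
    · rw [dual_mul_apply, h1', h2', map_mul]; rfl
  | inv ξ _ h1 =>
    obtain ⟨γ, h1, h1'⟩ := h1
    refine ⟨γ⁻¹, fun x => ?_, fun y => ?_⟩
    · rw [dual_inv_apply, h1, map_inv]; rfl
    · rw [dual_inv_apply, h1', map_inv]; rfl

variable {H : Type u} [CommGroup H] [TopologicalSpace H] [IsTopologicalGroup H] [CompactSpace H]
  [T2Space H] [SecondCountableTopology H] [MeasurableSpace H] [BorelSpace H]

/-- A product of coordinate characters restricts to a single γ on both sides. By injectivity its
integral is 1 when γ = 1 and 0 otherwise, for either measure. -/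
lemma map_evalHom_eq [Countable Γ] (p : Γ →* PontryaginDual G) (hp : Function.Injective p)
    (q : Γ →* PontryaginDual H) (hq : Function.Injective q) :
    (haarProb G).map (evalHom p) = (haarProb H).map (evalHom q) := by
  classical
  have hpm := (continuous_evalHom p).measurable
  have hqm := (continuous_evalHom q).measurable
  have : IsProbabilityMeasure ((haarProb G).map (evalHom p)) :=
    Measure.isProbabilityMeasure_map hpm.aemeasurable
  have : IsProbabilityMeasure ((haarProb H).map (evalHom q)) :=
    Measure.isProbabilityMeasure_map hqm.aemeasurable
  refine measure_ext_of_characters (Subgroup.closure (range (coordChar (Γ := Γ)))) ?_ _ _ ?_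
  · intro z w hzw
    obtain ⟨γ, hγ⟩ := Function.ne_iff.1 hzw
    exact ⟨coordChar γ, Subgroup.subset_closure ⟨γ, rfl⟩, hγ⟩
  · intro ξ hξ
    obtain ⟨γ, h1, h2⟩ := exists_eq_of_mem_closure_coordChar p q hξ
    have hξm : Continuous fun z => (ξ z : ℂ) := (charMap ξ).continuous
    rw [integral_map hpm.aemeasurable hξm.aestronglyMeasurable,
      integral_map hqm.aemeasurable hξm.aestronglyMeasurable]
    simp_rw [h1]
    have h2' : ∀ y, ξ (evalHom q y) = q γ y := h2
    simp_rw [h2', integral_character]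
    refine if_congr ?_ rfl rfl
    rw [map_eq_one_iff p hp, map_eq_one_iff q hq]

/-- The complement of the closed image of p is null for the common pushforward. Its preimage in H is
open and Haar null, hence empty. -/
lemma range_evalHom_le [Countable Γ] (p : Γ →* PontryaginDual G) (hp : Function.Injective p)
    (q : Γ →* PontryaginDual H) (hq : Function.Injective q) :
    (evalHom q).range ≤ (evalHom p).range := by
  have hcl : IsClosed (range (evalHom p)) := (isCompact_range (continuous_evalHom p)).isClosed
  have h0 : (haarProb H) (evalHom q ⁻¹' (range (evalHom p))ᶜ) = 0 := by
    rw [← Measure.map_apply (continuous_evalHom q).measurable hcl.measurableSet.compl,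
      ← map_evalHom_eq p hp q hq,
      Measure.map_apply (continuous_evalHom p).measurable hcl.measurableSet.compl]
    simp
  have h1 := ((hcl.isOpen_compl.preimage (continuous_evalHom q)).measure_eq_zero_iff
    (haarProb H)).1 h0
  rintro _ ⟨y, rfl⟩
  by_contra hy
  exact (h1 ▸ (show y ∈ evalHom q ⁻¹' (range (evalHom p))ᶜ from hy) : y ∈ (∅ : Set H))

end Evaluation

/-- Isomorphic groups of characters of two compact groups come from a common quotient. -/
lemma exists_common_quotient (G H : CompAb.{v}) {Γ : Type v} [Group Γ] [Countable Γ]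
    (p : Γ →* PontryaginDual G) (hp : Function.Injective p)
    (q : Γ →* PontryaginDual H) (hq : Function.Injective q) :
    ∃ (K : CompAb.{v}) (α : G →* K) (β : H →* K), Continuous α ∧ Function.Surjective α ∧
      Continuous β ∧ Function.Surjective β ∧ ∃ ev : Γ → PontryaginDual K,
        (∀ γ x, ev γ (α x) = p γ x) ∧ ∀ γ y, ev γ (β y) = q γ y := by
  have : CompactSpace (evalHom p).range :=
    isCompact_iff_compactSpace.1 (isCompact_range (continuous_evalHom p))
  have : SecondCountableTopology (evalHom p).range :=
    TopologicalSpace.Subtype.secondCountableTopology ((evalHom p).range : Set (Γ → Circle))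
  refine ⟨{ carrier := (evalHom p).range }, (evalHom p).rangeRestrict,
    (evalHom q).codRestrict (evalHom p).range fun y => range_evalHom_le p hp q hq ⟨y, rfl⟩,
    (continuous_evalHom p).subtype_mk _, (evalHom p).rangeRestrict_surjective,
    (continuous_evalHom q).subtype_mk _, ?_, fun γ =>
      (⟨(Pi.evalMonoidHom _ γ).comp (evalHom p).range.subtype,
        (continuous_apply γ).comp continuous_subtype_val⟩ : (evalHom p).range →ₜ* Circle),
    fun _ _ => rfl, fun _ _ => rfl⟩
  rintro ⟨z, hz⟩
  obtain ⟨y, rfl⟩ := range_evalHom_le q hq p hp hz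
  exact ⟨y, rfl⟩

lemma iso_of_discreteIso {g₁ g₂ : L2Fun.{v}} (h : DiscreteIso g₁.fourier g₂.fourier) :
    g₁.Iso g₂ := by
  let Γ := Subgroup.closure (Function.support g₁.fourier)
  let Δ := Subgroup.closure (Function.support g₂.fourier)
  obtain ⟨α, hα⟩ : ∃ α : Γ ≃* Δ, ∀ x : Γ, g₁.fourier x = g₂.fourier (α x) := h
  let p : Γ →* PontryaginDual g₁.grp := Γ.subtype
  let q : Γ →* PontryaginDual g₂.grp := Δ.subtype.comp α.toMonoidHom
  have hp : Function.Injective p := Subtype.val_injective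
  have hq : Function.Injective q := Subtype.val_injective.comp α.injective
  obtain ⟨K, α₁, α₂, hc₁, hs₁, hc₂, hs₂, ev, hev₁', hev₂'⟩ := exists_common_quotient _ _ p hp q hq
  have hm₁ := measurePreserving_epi α₁ hc₁ hs₁
  have hm₂ := measurePreserving_epi α₂ hc₂ hs₂
  have hev₁ : ∀ γ x, ev γ (α₁ x) = γ.1 x := hev₁'
  have hev₂ : ∀ γ y, ev γ (α₂ y) = (α γ).1 y := hev₂'
  have hΓ : ∀ χ, g₁.fourier χ ≠ 0 → χ ∈ Γ := fun χ hχ => Subgroup.subset_closure hχ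
  have hΔ : ∀ χ, g₂.fourier χ ≠ 0 → ∃ γ : Γ, (α γ).1 = χ := fun χ hχ =>
    ⟨α.symm ⟨χ, Subgroup.subset_closure hχ⟩, by rw [MulEquiv.apply_symm_apply]⟩
  let V : Lp ℂ 2 (haarProb K) →ₗᵢ[ℂ] Lp ℂ 2 (haarProb g₁.grp) :=
    Lp.compMeasurePreservingₗᵢ ℂ α₁ hm₁
  -- Pullback from K is an isometry, so its range is closed; it contains the characters of Γ, and
  -- these carry the Fourier series of g₁.
  obtain ⟨k, hk⟩ : g₁.memLp.toLp g₁.toFun ∈ V.toLinearMap.range := by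
    refine mem_of_charLp_mem g₁.memLp _ V.isometry.isClosedEmbedding.isClosed_range fun χ hχ => ?_
    refine ⟨charLp (ev ⟨χ, hΓ χ hχ⟩), ?_⟩
    refine Lp.ext ?_
    have h1 := hm₁.quasiMeasurePreserving.ae_eq_comp (coeFn_charLp (ev ⟨χ, hΓ χ hχ⟩))
    have h2 : V (charLp (ev ⟨χ, hΓ χ hχ⟩)) =ᵐ[haarProb g₁.grp] charLp (ev ⟨χ, hΓ χ hχ⟩) ∘ α₁ :=
      Lp.coeFn_compMeasurePreserving _ hm₁
    filter_upwards [h1, h2, coeFn_charLp χ] with x h3 h4 h5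
    rw [h5]
    exact h4.trans (h3.trans (congrArg (fun z : Circle => (z : ℂ)) (hev₁ ⟨χ, hΓ χ hχ⟩ x)))
  have hk₁ : ∀ᵐ x ∂(haarProb g₁.grp), k (α₁ x) = g₁.toFun x := by
    have h2 : V k =ᵐ[haarProb g₁.grp] k ∘ α₁ := Lp.coeFn_compMeasurePreserving _ hm₁
    have hk' : V k = g₁.memLp.toLp g₁.toFun := hk
    rw [hk'] at h2
    filter_upwards [h2, g₁.memLp.coeFn_toLp] with x h3 h4
    rw [← h4, h3]; rfl
  have hkm : AEStronglyMeasurable k (haarProb K) := (Lp.memLp k).1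
  refine ⟨⟨K, k, Lp.memLp k⟩, α₁, α₂, hc₁, hs₁, hc₂, hs₂, hk₁, ?_⟩
  refine ae_eq_of_fourier_eq ((Lp.memLp k).comp_measurePreserving hm₂) g₂.memLp fun χ => ?_
  change ∫ y, k (α₂ y) * conj (χ y : ℂ) ∂(haarProb g₂.grp) = g₂.fourier χ
  -- If χ is nontrivial on ker α₂, both coefficients vanish, because every character in the support
  -- of the transform of g₂ factors through α₂. Otherwise χ descends to K and is compared with its
  -- pullback χ₁ on the first group.
  by_cases hker : ∃ a, α₂ a = 1 ∧ χ a ≠ 1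
  · obtain ⟨a, ha, hχa⟩ := hker
    refine (integral_comp_mul_conj_eq_zero (measurePreserving_mul_left _) α₂ k
      (χ : g₂.grp →* Circle) ha hχa).trans ?_
    by_contra hne
    obtain ⟨γ, hγ⟩ := hΔ χ (Ne.symm hne)
    refine hχa ?_
    rw [← hγ, ← hev₂, ha, map_one]
  · push Not at hker
    let ψ₀ : K →* Circle := α₂.liftOfSurjective hs₂ ⟨(χ : g₂.grp →* Circle), hker⟩
    have hcomp : ψ₀.comp α₂ = (χ : g₂.grp →* Circle) := MonoidHom.liftOfRightInverse_comp _ _ _ _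
    have hψ₀ : ∀ y, ψ₀ (α₂ y) = χ y := fun y => DFunLike.congr_fun hcomp y
    have hψc : Continuous ψ₀ := by
      refine continuous_of_comp_surjective hc₂ hs₂ ?_
      have : ψ₀ ∘ α₂ = χ := funext hψ₀
      rw [this]
      exact map_continuous χ
    let ψ : PontryaginDual K := (⟨ψ₀, hψc⟩ : K →ₜ* Circle)
    have hψ : ∀ y, ψ (α₂ y) = χ y := hψ₀
    let χ₁ : PontryaginDual g₁.grp := (⟨ψ₀.comp α₁, hψc.comp hc₁⟩ : g₁.grp →ₜ* Circle)
    have hχ₁ : ∀ x, ψ (α₁ x) = χ₁ x := fun _ => rfl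
    have h1 : ∫ y, k (α₂ y) * conj (χ y : ℂ) ∂(haarProb g₂.grp) = g₁.fourier χ₁ := by
      simp_rw [← hψ]
      rw [integral_comp_mul_conj hm₂ hkm, ← integral_comp_mul_conj hm₁ hkm]
      exact integral_congr_ae (hk₁.mono fun x hx => by simp only [hx, hχ₁])
    rw [h1]
    by_cases hmem : χ₁ ∈ Γ
    · have h2 := hα ⟨χ₁, hmem⟩
      refine h2.trans (congrArg g₂.fourier (PontryaginDual.ext fun y => ?_))
      rw [← hψ, ← hev₂]
      obtain ⟨x, hx⟩ := hs₁ (α₂ y)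
      rw [← hx, hev₁, hχ₁]
    · have h2 : g₁.fourier χ₁ = 0 := by
        by_contra hne
        exact hmem (hΓ _ hne)
      rw [h2]
      by_contra hne
      obtain ⟨γ, hγ⟩ := hΔ χ (Ne.symm hne)
      refine hmem ?_
      convert γ.2 using 1
      refine PontryaginDual.ext fun x => ?_
      rw [← hχ₁, ← hev₁]
      obtain ⟨y, hy⟩ := hs₂ (α₁ x)
      rw [← hy, hψ, ← hγ, hev₂]

/-! ### The `σ`-topology -/

section SigmaTopology

variable {ω : Ultrafilter ℕ} {X : ℕ → Type u} [∀ i, TopologicalSpace (X i)]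

lemma isSigmaOpen_union {S T : Set (UltraProd ω X)} (hS : IsSigmaOpen ω S) (hT : IsSigmaOpen ω T) :
    IsSigmaOpen ω (S ∪ T) := by
  rw [union_eq_iUnion]
  exact isSigmaOpen_iUnion ω (Bool.forall_bool.2 ⟨hT, hS⟩)

lemma IsSigmaOpen.measurableSet {S : Set (UltraProd ω X)} (hS : IsSigmaOpen ω S) :
    MeasurableSet S := by
  obtain ⟨U, hU, rfl⟩ := hS
  exact MeasurableSet.iUnion fun n => MeasurableSpace.measurableSet_generateFrom (hU n)

lemma SigmaContinuous.measurable {T : Type v} [TopologicalSpace T] [MeasurableSpace T]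
    [BorelSpace T] {φ : UltraProd ω X → T} (hφ : SigmaContinuous ω φ) : Measurable φ :=
  measurable_of_isOpen fun V hV => (hφ V hV).measurableSet

lemma _root_.Continuous.comp_sigmaContinuous {T T' : Type*} [TopologicalSpace T]
    [TopologicalSpace T'] {ψ : T → T'} (hψ : Continuous ψ) {φ : UltraProd ω X → T}
    (hφ : SigmaContinuous ω φ) : SigmaContinuous ω (ψ ∘ φ) :=
  fun _ hV => hφ _ (hV.preimage hψ)

lemma SigmaContinuous.codRestrict {T : Type*} [TopologicalSpace T] {φ : UltraProd ω X → T}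
    (hφ : SigmaContinuous ω φ) {s : Set T} (hs : ∀ x, φ x ∈ s) :
    SigmaContinuous ω (s.codRestrict φ hs) := by
  rintro _ ⟨V, hV, rfl⟩
  exact hφ V hV

/-- σ-open sets are closed only under countable unions, so an open set must first be reduced to
countably many basic boxes. -/
lemma sigmaContinuous_pi {ι : Type*} [Countable ι] {T : ι → Type*} [∀ j, TopologicalSpace (T j)]
    [∀ j, SecondCountableTopology (T j)] {φ : UltraProd ω X → ∀ j, T j}
    (hφ : ∀ j, SigmaContinuous ω fun x => φ x j) : SigmaContinuous ω φ := by
  classical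
  intro V hV
  have hB := isTopologicalBasis_pi (X := T) fun j => TopologicalSpace.isTopologicalBasis_opens
  have hbasic : ∀ W ∈ {S : Set (∀ j, T j) | ∃ (U : ∀ j, Set (T j)) (F : Finset ι),
      (∀ i, i ∈ F → U i ∈ {U : Set (T i) | IsOpen U}) ∧ S = (F : Set ι).pi U},
      IsSigmaOpen ω (φ ⁻¹' W) := by
    rintro _ ⟨U, F, hU, rfl⟩
    induction F using Finset.induction_on with
    | empty =>
      convert isSigmaOpen_univ ω (X := X) using 1
      ext x; simp
    | insert j F _ ih =>
      rw [Finset.coe_insert, insert_pi, preimage_inter]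
      exact isSigmaOpen_inter ω (hφ j _ (hU j (Finset.mem_insert_self j F)))
        (ih fun i hi => hU i (Finset.mem_insert_of_mem hi))
  obtain ⟨S, hS, rfl⟩ := hB.open_eq_sUnion hV
  obtain ⟨S', hc, hsub, heq⟩ :=
    TopologicalSpace.isOpen_sUnion_countable S fun s hs => hB.isOpen (hS hs)
  have := hc.to_subtype
  rw [← heq, sUnion_eq_iUnion, preimage_iUnion]
  exact isSigmaOpen_iUnion ω fun s => hbasic _ (hS (hsub s.2))

variable [∀ i, Nonempty (X i)]

/-- The `σ`-topology is countably compact. -/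
lemma exists_finite_subcover_of_isSigmaOpen (hω : (ω : Filter ℕ) ≤ cofinite)
    {S : ℕ → Set (UltraProd ω X)} (hS : ∀ n, IsSigmaOpen ω (S n)) (hcov : ⋃ n, S n = univ) :
    ∃ N, ∀ x, ∃ n < N, x ∈ S n := by
  choose U hU hSU using hS
  choose V hV hUV using hU
  obtain ⟨N, hN⟩ := exists_finite_subcover ω hω
    (S := fun k => V k.unpair.1 k.unpair.2) (T := fun _ => univ) (by
      intro x _
      obtain ⟨n, hn⟩ := mem_iUnion.1 (hcov ▸ mem_univ x : x ∈ ⋃ n, S n)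
      rw [hSU] at hn
      obtain ⟨m, hm⟩ := mem_iUnion.1 hn
      refine mem_iUnion.2 ⟨Nat.pair n m, ?_⟩
      simp only [Nat.unpair_pair]
      rwa [← hUV])
  refine ⟨N, fun x => ?_⟩
  obtain ⟨a, rfl⟩ := mk_surjective ω x
  by_contra! hc
  have h1 : ∀ᶠ i in (ω : Filter ℕ), ∀ k ∈ Finset.range N, a i ∉ V k.unpair.1 k.unpair.2 i := by
    rw [Filter.eventually_all_finset]
    intro k hk
    rw [Ultrafilter.eventually_not, ← mk_mem_ultraSet, ← hUV]
    intro hmem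
    refine hc _ ((Nat.unpair_left_le k).trans_lt (Finset.mem_range.1 hk)) ?_
    rw [hSU]
    exact mem_iUnion.2 ⟨_, hmem⟩
  obtain ⟨i, hi, hi'⟩ := (h1.and hN).exists
  obtain ⟨k, hk, hmem⟩ := mem_iUnion₂.1 (hi' (mem_univ (a i)))
  exact hi k hk hmem

/-- `σ`-continuous maps into metrizable spaces are closed. -/
lemma isClosed_image_of_sigmaContinuous (hω : (ω : Filter ℕ) ≤ cofinite) {T : Type v}
    [TopologicalSpace T] [TopologicalSpace.MetrizableSpace T] {φ : UltraProd ω X → T}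
    (hφ : SigmaContinuous ω φ) {F : Set (UltraProd ω X)} (hF : IsSigmaOpen ω Fᶜ) :
    IsClosed (φ '' F) := by
  let := TopologicalSpace.metrizableSpaceMetric T
  refine isClosed_of_closure_subset fun y hy => ?_
  by_contra hne
  -- If y is not in the image, these sets pulled back cover F; a finite subcover keeps φ(F) a
  -- positive distance from y.
  have hopen : ∀ n : ℕ, IsOpen {z : T | 1 / ((n : ℝ) + 1) < dist z y} := fun n =>
    isOpen_lt continuous_const (continuous_id.dist continuous_const)
  obtain ⟨N, hN⟩ := exists_finite_subcover_of_isSigmaOpen hω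
    (S := fun n => Fᶜ ∪ φ ⁻¹' {z : T | 1 / ((n : ℝ) + 1) < dist z y})
    (fun n => isSigmaOpen_union hF (hφ _ (hopen n))) (by
      refine eq_univ_of_forall fun x => ?_
      by_cases hx : x ∈ F
      · have hd : 0 < dist (φ x) y := dist_pos.2 fun h => hne ⟨x, hx, h⟩
        obtain ⟨n, hn⟩ := exists_nat_one_div_lt hd
        exact mem_iUnion.2 ⟨n, Or.inr hn⟩
      · exact mem_iUnion.2 ⟨0, Or.inl hx⟩)
  obtain ⟨_, ⟨x, hx, rfl⟩, hd⟩ := Metric.mem_closure_iff.1 hy (1 / ((N : ℝ) + 1)) (by positivity)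
  obtain ⟨n, hn, h | h⟩ := hN x
  · exact h hx
  · have h' : 1 / ((n : ℝ) + 1) < dist (φ x) y := h
    rw [dist_comm] at h'
    have hle : 1 / ((N : ℝ) + 1) ≤ 1 / ((n : ℝ) + 1) := by
      gcongr
    linarith

end SigmaTopology

/-! ### Characters of the ultraproduct and compact quotients -/

section UltraGroup

variable {ω : Ultrafilter ℕ} {A : ℕ → Type u} [∀ i, CommGroup (A i)]
  [∀ i, TopologicalSpace (A i)]

/-- A homomorphism on a metrizable quotient is continuous if it is on the ultraproduct. -/
lemma continuous_of_sigmaContinuous_comp (hω : (ω : Filter ℕ) ≤ cofinite) {T Z : Type*}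
    [TopologicalSpace T] [TopologicalSpace.MetrizableSpace T] [TopologicalSpace Z]
    {φ : UltraProd ω A → T} (hφ : SigmaContinuous ω φ) (hs : Function.Surjective φ) {ψ : T → Z}
    (h : SigmaContinuous ω (ψ ∘ φ)) : Continuous ψ := by
  refine continuous_iff_isClosed.2 fun C hC => ?_
  have h1 : ψ ⁻¹' C = φ '' ((ψ ∘ φ) ⁻¹' C) := by
    rw [preimage_comp, image_preimage_eq _ hs]
  rw [h1]
  exact isClosed_image_of_sigmaContinuous hω hφ (h _ hC.isOpen_compl)

/-- Countably many characters of the ultraproduct factor over a second countable compact group. -/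
lemma exists_compact_quotient (hω : (ω : Filter ℕ) ≤ cofinite) (χ : ℕ → ultraDual ω A) :
    ∃ (B : CompAb.{v}) (φ : UltraProd ω A →* B), SigmaContinuous ω φ ∧ Function.Surjective φ ∧
      ∃ c : ℕ → PontryaginDual B, ∀ n x, c n (φ x) = (χ n).1 x := by
  -- Lifting the index set puts the quotient group in the required universe.
  let E : UltraProd ω A →* (ULift.{v} ℕ → Circle) :=
    { toFun := fun x n => (χ n.down).1 x
      map_one' := by ext n; simp
      map_mul' := fun x y => by ext n; simp }
  have hE : SigmaContinuous ω E := sigmaContinuous_pi fun n => (χ n.down).2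
  have hcl : IsClosed (range E) := by
    rw [← image_univ]
    exact isClosed_image_of_sigmaContinuous hω hE (by simpa using isSigmaOpen_empty ω)
  have : CompactSpace E.range := isCompact_iff_compactSpace.1 hcl.isCompact
  have : SecondCountableTopology E.range :=
    TopologicalSpace.Subtype.secondCountableTopology (E.range : Set (ULift.{v} ℕ → Circle))
  have hφ : SigmaContinuous ω E.rangeRestrict :=
    hE.codRestrict (s := (E.range : Set (ULift.{v} ℕ → Circle))) fun x => ⟨x, rfl⟩
  exact ⟨{ carrier := E.range }, E.rangeRestrict, hφ,
    E.rangeRestrict_surjective, fun n =>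
      (⟨(Pi.evalMonoidHom _ (ULift.up n)).comp E.range.subtype,
        (continuous_apply _).comp continuous_subtype_val⟩ : E.range →ₜ* Circle), fun _ _ => rfl⟩

/-- Characters of B generate its Borel sets, and their pullbacks along φ are linear characters. -/
lemma comap_le_fourierSigma {B : CompAb.{v}} {φ : UltraProd ω A →* B}
    (hφ : SigmaContinuous ω φ) :
    MeasurableSpace.comap φ (inferInstance : MeasurableSpace B) ≤ fourierSigma ω A := by
  refine (MeasurableSpace.comap_mono borel_le_iSup_comap_characters).trans ?_
  rw [MeasurableSpace.comap_iSup]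
  refine iSup_le fun ψ => ?_
  rw [MeasurableSpace.comap_comp]
  exact le_iSup (fun χ : ultraDual ω A =>
    MeasurableSpace.comap (fun x => (χ.1 x : ℂ)) (borel ℂ))
    ⟨(ψ : B →* Circle).comp φ, (map_continuous ψ).comp_sigmaContinuous hφ⟩

/-- A measurable function with values in a second countable space is measurable with respect to
countably many members of a family generating the `σ`-algebra. -/
lemma _root_.Measurable.exists_countable_iSup {X Z ι : Type*} {m : ι → MeasurableSpace X}
    [TopologicalSpace Z] [SecondCountableTopology Z] [mZ : MeasurableSpace Z] [BorelSpace Z] {f : X → Z}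
    (hf : Measurable[⨆ i, m i] f) : ∃ I : Set ι, I.Countable ∧ Measurable[⨆ i ∈ I, m i] f := by
  have hset : ∀ s, MeasurableSet[⨆ i, m i] s →
      ∃ I : Set ι, I.Countable ∧ MeasurableSet[⨆ i ∈ I, m i] s := by
    intro s hs
    rw [MeasurableSpace.measurableSet_iSup] at hs
    induction hs with
    | basic s hs =>
      obtain ⟨i, hi⟩ := hs
      exact ⟨{i}, countable_singleton i, by rw [iSup_singleton]; exact hi⟩
    | empty => exact ⟨∅, countable_empty, @MeasurableSet.empty _ (_)⟩
    | compl s _ ih =>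
      obtain ⟨I, hI, h⟩ := ih
      exact ⟨I, hI, h.compl⟩
    | iUnion s _ ih =>
      choose I hI h using ih
      refine ⟨⋃ n, I n, countable_iUnion hI, ?_⟩
      refine MeasurableSet.iUnion fun n => ?_
      exact (biSup_mono (f := m) (fun i hi => mem_iUnion.2 ⟨n, hi⟩) :
        (⨆ i ∈ I n, m i) ≤ ⨆ i ∈ ⋃ n, I n, m i) _ (h n)
  let C := TopologicalSpace.countableBasis Z
  have hC : C.Countable := TopologicalSpace.countable_countableBasis Z
  have := hC.to_subtype
  choose I hI h using fun U : C => hset (f ⁻¹' U)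
    (hf (TopologicalSpace.isOpen_of_mem_countableBasis U.2).measurableSet)
  refine ⟨⋃ U, I U, countable_iUnion hI, ?_⟩
  have hgen : mZ = MeasurableSpace.generateFrom C :=
    (BorelSpace.measurable_eq (α := Z)).trans
      (TopologicalSpace.isBasis_countableBasis Z).borel_eq_generateFrom
  rw [hgen]
  refine @measurable_generateFrom _ _ (⨆ i ∈ ⋃ U, I U, m i) _ _ fun U hU => ?_
  exact (biSup_mono (f := m) (fun i hi => mem_iUnion.2 ⟨⟨U, hU⟩, hi⟩) :
    (⨆ i ∈ I ⟨U, hU⟩, m i) ≤ ⨆ i ∈ ⋃ U, I U, m i) _ (h ⟨U, hU⟩)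

/-- A function that is measurable in the Fourier `σ`-algebra factors over a second countable compact
group. -/
lemma exists_eq_comp_of_measurable_fourierSigma (hω : (ω : Filter ℕ) ≤ cofinite)
    {f : UltraProd ω A → ℂ} (hf : Measurable[fourierSigma ω A] f) :
    ∃ (B : CompAb.{v}) (φ : UltraProd ω A →* B) (h : B → ℂ), SigmaContinuous ω φ ∧
      Function.Surjective φ ∧ Measurable h ∧ f = h ∘ φ := by
  obtain ⟨I, hI, hfI⟩ := Measurable.exists_countable_iSup hf
  -- Adding the trivial character ensures a nonempty set, which can be enumerated by ℕ.
  obtain ⟨χ, hχ⟩ := (hI.insert 1).exists_eq_range (insert_nonempty _ _)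
  obtain ⟨B, φ, hφ, hs, c, hc⟩ := exists_compact_quotient.{u, v} hω χ
  have hle : (⨆ i ∈ I, MeasurableSpace.comap (fun x => (i.1 x : ℂ)) (borel ℂ)) ≤
      MeasurableSpace.comap φ (inferInstance : MeasurableSpace B) := by
    refine iSup₂_le fun i hi => ?_
    obtain ⟨n, rfl⟩ : i ∈ range χ := hχ ▸ mem_insert_of_mem _ hi
    have h1 : (fun x => ((χ n).1 x : ℂ)) = (fun b => (c n b : ℂ)) ∘ φ := by
      ext x
      simp only [Function.comp_apply, hc]
    rw [h1, ← MeasurableSpace.comap_comp]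
    refine MeasurableSpace.comap_mono ?_
    rw [← BorelSpace.measurable_eq (α := ℂ)]
    exact (charMap (c n)).continuous.measurable.comap_le
  obtain ⟨h, hh, rfl⟩ := Measurable.exists_eq_measurable_comp (hfI.mono hle le_rfl)
  exact ⟨B, φ, h, hφ, hs, hh, rfl⟩

/-! ### Invariance of the ultralimit measure and factorization -/

variable [∀ i, IsTopologicalGroup (A i)] [∀ i, CompactSpace (A i)]
  [∀ i, MeasurableSpace (A i)] [∀ i, BorelSpace (A i)]

/-- The ultralimit of Haar measures is translation invariant. -/
lemma measurePreserving_mul_left_ultraHaar (a : UltraProd ω A) :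
    MeasurePreserving (a * ·) (ultraHaar ω A) (ultraHaar ω A) := by
  obtain ⟨a, rfl⟩ := mk_surjective ω a
  have hpre : ∀ U : ∀ i, Set (A i), (UltraProd.mk ω a * ·) ⁻¹' ultraSet ω U =
      ultraSet ω fun i => (a i * ·) ⁻¹' U i := by
    intro U
    ext x
    obtain ⟨b, rfl⟩ := mk_surjective ω x
    rw [mem_preimage, mk_mul, mk_mem_ultraSet, mk_mem_ultraSet]
    rfl
  have hopen : ∀ U : ∀ i, Set (A i), (∀ i, IsOpen (U i)) →
      ∀ i, IsOpen ((a i * ·) ⁻¹' U i) := fun U hU i =>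
    (hU i).preimage (continuous_const_mul (a i))
  have hm : Measurable (UltraProd.mk ω a * ·) := by
    refine measurable_generateFrom ?_
    rintro _ ⟨U, hU, rfl⟩
    rw [hpre]
    exact MeasurableSpace.measurableSet_generateFrom ⟨_, hopen U hU, rfl⟩
  refine ⟨hm, ?_⟩
  have : IsProbabilityMeasure ((ultraHaar ω A).map (UltraProd.mk ω a * ·)) :=
    Measure.isProbabilityMeasure_map hm.aemeasurable
  -- The strongly open sets form a generating π-system, on which invariance is a limit of invariance
  -- in each coordinate.
  refine ext_of_generate_finite {S | IsStronglyOpen ω S} rfl ?_ ?_ (by simp)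
  · rintro _ ⟨U, hU, rfl⟩ _ ⟨V, hV, rfl⟩ _
    exact ⟨_, fun i => (hU i).inter (hV i), ultraSet_inter ω U V⟩
  · rintro _ ⟨U, hU, rfl⟩
    rw [Measure.map_apply hm (MeasurableSpace.measurableSet_generateFrom ⟨U, hU, rfl⟩), hpre]
    refine tendsto_nhds_unique (tendsto_ultraMeasure ω _ (hopen U hU)) ?_
    simp_rw [measure_preimage_mul]
    exact tendsto_ultraMeasure ω _ hU

lemma aestronglyMeasurable_fourierSigma_iff (hω : (ω : Filter ℕ) ≤ cofinite)
    {f : UltraProd ω A → ℂ} (hf : MemLp f ⊤ (ultraHaar ω A)) :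
    AEStronglyMeasurable[fourierSigma ω A] f (ultraHaar ω A) ↔
      ∃ (B : CompAb.{v}) (φ : UltraProd ω A →* B) (h : B → ℂ), IsFactorization ω f B φ h := by
  constructor
  · rintro ⟨f', hf', hff'⟩
    obtain ⟨B, φ, h, hφ, hs, hh, rfl⟩ :=
      exists_eq_comp_of_measurable_fourierSigma.{u, v} hω hf'.measurable
    have hmp := measurePreserving_of_surjective measurePreserving_mul_left_ultraHaar φ
      hφ.measurable hs
    refine ⟨B, φ, h, hφ, hs, hmp, ?_, hff'⟩
    rw [← hmp.map_eq, memLp_map_measure_iff hh.aestronglyMeasurable hφ.measurable.aemeasurable]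
    exact (memLp_congr_ae hff').1 hf
  · rintro ⟨B, φ, h, H⟩
    -- h is only almost everywhere measurable, so a strongly measurable representative is pulled
    -- back in its place.
    obtain ⟨h₀, hh₀, he⟩ := H.memLp.1
    refine ⟨h₀ ∘ φ, ?_, H.ae_eq.trans (H.measurePreserving.quasiMeasurePreserving.ae_eq_comp he)⟩
    have hφ : Measurable[fourierSigma ω A] φ :=
      measurable_iff_comap_le.2 (comap_le_fourierSigma H.continuous)
    exact hh₀.comp_measurable hφ

/-- Non-principality enters through closedness of φ: a linear character that factors through φ is
continuous on B. -/
lemma IsFactorization.discreteIso (hω : (ω : Filter ℕ) ≤ cofinite) {f : UltraProd ω A → ℂ}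
    {B : CompAb.{v}} {φ : UltraProd ω A →* B} {h : B → ℂ} (H : IsFactorization ω f B φ h) :
    DiscreteIso (L2Fun.ofLinfty B h H.memLp).fourier (ultraFourier ω f) :=
  discreteIso_fourier_comp (ultraDual ω A) measurePreserving_mul_left_ultraHaar φ H.surjective
    H.measurePreserving H.memLp.1
    (fun ψ => (map_continuous ψ).comp_sigmaContinuous H.continuous)
    (fun _ hψ => continuous_of_sigmaContinuous_comp hω H.continuous H.surjective hψ) H.ae_eq

end UltraGroup

end UltraFourier

end

theorem mainTheorem7 (ω : Ultrafilter ℕ) (hω : (ω : Filter ℕ) ≤ Filter.cofinite)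
    (A : ℕ → Type u) [∀ i, CommGroup (A i)] [∀ i, TopologicalSpace (A i)]
    [∀ i, IsTopologicalGroup (A i)] [∀ i, CompactSpace (A i)] [∀ i, T2Space (A i)]
    [∀ i, MeasurableSpace (A i)] [∀ i, BorelSpace (A i)]
    (f : UltraProd ω A → ℂ) (hf : MemLp f ⊤ (ultraHaar ω A)) :
    (AEStronglyMeasurable[fourierSigma ω A] f (ultraHaar ω A) ↔
      ∃ (B : CompAb.{v}) (φ : UltraProd ω A →* B) (h : B → ℂ), IsFactorization ω f B φ h) ∧
    ∀ (B : CompAb.{v}) (φ : UltraProd ω A →* B) (h : B → ℂ) (H : IsFactorization ω f B φ h),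
      (∀ g ∈ classQ.{u, v} ω f, (L2Fun.ofLinfty B h H.memLp).dist g = 0) ∧
      (L2Fun.ofLinfty B h H.memLp).isoClass = classQ.{u, v} ω f := by
  refine ⟨aestronglyMeasurable_fourierSigma_iff hω hf, fun B φ h H => ⟨fun g hg => ?_, ?_⟩⟩
  · exact discreteDist_eq_zero_of_discreteIso ((H.discreteIso hω).trans (DiscreteIso.symm hg))
  · ext g
    exact ⟨fun hg => (discreteIso_of_iso hg).trans (H.discreteIso hω),
      fun hg => iso_of_discreteIso (DiscreteIso.trans hg (H.discreteIso hω).symm)⟩
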